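/- **Theorem (inf–sup identity).** Let $d\ge 1$, let $\Omega\subset\mathbb{R}^d$ be a nonempty bounded open set, and let $T>0$. Write $\|\cdot\|_\Omega$ and $(\cdot,\cdot)_\Omega$ for the norm and inner product of $L^2(\Omega)$ and of $L^2(\Omega;\mathbb{R}^d)$. Let $H^1_0(\Omega)$ be the closure of $C_0^\infty(\Omega)$ in $H^1(\Omega)$, and let $H^{-1}(\Omega)$ be its dual space, with duality pairing $\langle\cdot,\cdot\rangle$ and norm $$\|\Phi\|_{H^{-1}(\Omega)}=\sup_{v\in H^1_0(\Omega)\setminus\{0\}}\frac{\langle\Phi,v\rangle}{\|\nabla v\|_\Omega};$$ $L^2(\Omega)$ is embedded in $H^{-1}(\Omega)$ by $\langle w,v\rangle=(w,v)_\Omega$. Let $$X=L^2(0,T;H^1_0(\Omega)),\qquad \|v\|_X^2=\int_0^T\|\nabla v\|_\Omega^2\,dt,$$ and let $Y=L^2(0,T;H^1_0(\Omega))\cap H^1(0,T;H^{-1}(\Omega))$ be the space of those $\varphi\in X$ that, regarded as $H^{-1}(\Omega)$-valued functions, have a weak time derivative $\partial_t\varphi\in L^2(0,T;H^{-1}(\Omega))$.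 Every $\varphi\in Y$ has a unique representative in $C([0,T];L^2(\Omega))$, through which the values $\varphi(0),\varphi(T)\in L^2(\Omega)$ are defined. Let $$Y_T=\{\varphi\in Y:\varphi(T)=0\},\qquad \|\varphi\|_{Y_T}^2=\int_0^T\left(\|\partial_t\varphi\|_{H^{-1}(\Omega)}^2+\|\nabla\varphi\|_\Omega^2\right)dt+\|\varphi(0)\|_\Omega^2 ,$$ and, for $v\in X$ and $\varphi\in Y_T$, $$B_X(v,\varphi)=\int_0^T\left[-\langle\partial_t\varphi,v\rangle+(\nabla v,\nabla\varphi)_\Omega\right]dt .$$ Then, for every $v\in X$, $$\|v\|_X=\sup_{\varphi\in Y_T\setminus\{0\}}\frac{B_X(v,\varphi)}{\|\varphi\|_{Y_T}} .$$ -/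

import Mathlib

open MeasureTheory Set
open scoped ContDiff ENNReal

noncomputable section

namespace HeatSpaces

/-- `φ ∈ C₀^∞(S)`: a real-valued smooth function whose support is a compact subset of `S`. -/
structure IsTestFun {E : Type*} [NormedAddCommGroup E] [NormedSpace ℝ E]
    (S : Set E) (φ : E → ℝ) : Prop where
  contDiff : ContDiff ℝ ∞ φ
  hasCompactSupport : HasCompactSupport φ
  tsupport_subset : tsupport φ ⊆ S

section TestFun

variable {E : Type*} [NormedAddCommGroup E] [NormedSpace ℝ E] {S : Set E} {φ ψ : E → ℝ}

lemma IsTestFun.zero : IsTestFun S (0 : E → ℝ) :=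
  ⟨contDiff_const, HasCompactSupport.zero, by simp [tsupport]⟩

lemma IsTestFun.add (hφ : IsTestFun S φ) (hψ : IsTestFun S ψ) : IsTestFun S (φ + ψ) :=
  ⟨hφ.contDiff.add hψ.contDiff, hφ.hasCompactSupport.add hψ.hasCompactSupport,
    (tsupport_add φ ψ).trans (union_subset hφ.tsupport_subset hψ.tsupport_subset)⟩

lemma IsTestFun.const_smul (c : ℝ) (hφ : IsTestFun S φ) : IsTestFun S (c • φ) :=
  ⟨hφ.contDiff.const_smul c, hφ.hasCompactSupport.smul_left (f := fun _ => c),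
    (tsupport_smul_subset_right (fun _ => c) φ).trans hφ.tsupport_subset⟩

lemma IsTestFun.memLp [MeasurableSpace E] [BorelSpace E] {μ : Measure E}
    [IsFiniteMeasureOnCompacts μ] (hφ : IsTestFun S φ) : MemLp φ 2 μ :=
  hφ.contDiff.continuous.memLp_of_hasCompactSupport hφ.hasCompactSupport

lemma IsTestFun.memLp_fderiv [MeasurableSpace E] [BorelSpace E] {μ : Measure E}
    [IsFiniteMeasureOnCompacts μ] (hφ : IsTestFun S φ) (e : E) :
    MemLp (fun x => fderiv ℝ φ x e) 2 μ :=
  ((hφ.contDiff.continuous_fderiv (by simp)).clm_apply continuous_const).memLp_of_hasCompactSupport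
    (hφ.hasCompactSupport.fderiv_apply (𝕜 := ℝ) e)

end TestFun

/-! ### Spaces on the spatial domain -/

/-- `L²(Ω)`. -/
abbrev L2 {d : ℕ} (Ω : Set (EuclideanSpace ℝ (Fin d))) : Type :=
  Lp ℝ 2 (volume.restrict Ω)

/-- `L²(Ω; ℝᵈ)`. -/
abbrev L2Vec {d : ℕ} (Ω : Set (EuclideanSpace ℝ (Fin d))) : Type :=
  Lp (EuclideanSpace ℝ (Fin d)) 2 (volume.restrict Ω)

/-- `g` is the weak gradient of `u` in `Ω`: `∫_Ω u ∂ᵢφ = - ∫_Ω gᵢ φ` for all test functions `φ`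
and all `i`. -/
def HasWeakGrad {d : ℕ} (Ω : Set (EuclideanSpace ℝ (Fin d)))
    (u : EuclideanSpace ℝ (Fin d) → ℝ)
    (g : EuclideanSpace ℝ (Fin d) → EuclideanSpace ℝ (Fin d)) : Prop :=
  ∀ φ : EuclideanSpace ℝ (Fin d) → ℝ, IsTestFun Ω φ → ∀ i : Fin d,
    ∫ x in Ω, u x * fderiv ℝ φ x (EuclideanSpace.single i 1) = - ∫ x in Ω, g x i * φ x

section Aux

variable {d : ℕ} {Ω : Set (EuclideanSpace ℝ (Fin d))}

lemma integrable_mul_test (u : L2 Ω) {φ : EuclideanSpace ℝ (Fin d) → ℝ}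
    (hφ : MemLp φ 2 (volume.restrict Ω)) :
    Integrable (fun x => u x * φ x) (volume.restrict Ω) :=
  (Lp.memLp u).integrable_mul hφ

lemma integrable_coord_mul_test (g : L2Vec Ω) (i : Fin d) {φ : EuclideanSpace ℝ (Fin d) → ℝ}
    (hφ : MemLp φ 2 (volume.restrict Ω)) :
    Integrable (fun x => g x i * φ x) (volume.restrict Ω) := by
  have h : MemLp (fun x => g x i) 2 (volume.restrict Ω) :=
    (EuclideanSpace.proj (𝕜 := ℝ) i).comp_memLp' (Lp.memLp g)
  exact h.integrable_mul hφ

end Aux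

/-- `H¹(Ω)`: the functions in `L²(Ω)` with weak gradient in `L²(Ω; ℝᵈ)`. A function is stored with
its (unique) weak gradient as a pair `(u, ∇u)`, so that the norm inherited from the Hilbert sum is
`‖u‖² = ‖u‖²_Ω + ‖∇u‖²_Ω`. -/
def H1 {d : ℕ} (Ω : Set (EuclideanSpace ℝ (Fin d))) :
    Submodule ℝ (WithLp 2 (L2 Ω × L2Vec Ω)) where
  carrier := {p | HasWeakGrad Ω p.fst p.snd}
  zero_mem' := by
    intro φ hφ i
    have h1 : ((0 : WithLp 2 (L2 Ω × L2Vec Ω)).fst : EuclideanSpace ℝ (Fin d) → ℝ)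
        =ᵐ[volume.restrict Ω] 0 := Lp.coeFn_zero _ _ _
    have h2 : ((0 : WithLp 2 (L2 Ω × L2Vec Ω)).snd :
        EuclideanSpace ℝ (Fin d) → EuclideanSpace ℝ (Fin d))
        =ᵐ[volume.restrict Ω] 0 := Lp.coeFn_zero _ _ _
    rw [integral_eq_zero_of_ae, integral_eq_zero_of_ae, neg_zero]
    · filter_upwards [h2] with x hx
      rw [hx]; simp
    · filter_upwards [h1] with x hx
      rw [hx]; simp
  add_mem' := by
    intro p q hp hq φ hφ i
    have h1 : ((p + q).fst : EuclideanSpace ℝ (Fin d) → ℝ)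
        =ᵐ[volume.restrict Ω] p.fst + q.fst := Lp.coeFn_add _ _
    have h2 : ((p + q).snd : EuclideanSpace ℝ (Fin d) → EuclideanSpace ℝ (Fin d))
        =ᵐ[volume.restrict Ω] p.snd + q.snd := Lp.coeFn_add _ _
    have e1 : ∫ x in Ω, (p + q).fst x * fderiv ℝ φ x (EuclideanSpace.single i 1)
        = ∫ x in Ω, (p.fst x * fderiv ℝ φ x (EuclideanSpace.single i 1)
          + q.fst x * fderiv ℝ φ x (EuclideanSpace.single i 1)) := by
      refine integral_congr_ae ?_
      filter_upwards [h1] with x hx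
      simp only [hx, Pi.add_apply, add_mul]
    have e2 : ∫ x in Ω, (p + q).snd x i * φ x
        = ∫ x in Ω, (p.snd x i * φ x + q.snd x i * φ x) := by
      refine integral_congr_ae ?_
      filter_upwards [h2] with x hx
      simp only [hx, Pi.add_apply, PiLp.add_apply, add_mul]
    rw [e1, e2, integral_add (integrable_mul_test _ (hφ.memLp_fderiv _))
      (integrable_mul_test _ (hφ.memLp_fderiv _)),
      integral_add (integrable_coord_mul_test _ i hφ.memLp)
      (integrable_coord_mul_test _ i hφ.memLp), hp φ hφ i, hq φ hφ i]
    ring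
  smul_mem' := by
    intro c p hp φ hφ i
    have h1 : ((c • p).fst : EuclideanSpace ℝ (Fin d) → ℝ)
        =ᵐ[volume.restrict Ω] c • p.fst := Lp.coeFn_smul _ _
    have h2 : ((c • p).snd : EuclideanSpace ℝ (Fin d) → EuclideanSpace ℝ (Fin d))
        =ᵐ[volume.restrict Ω] c • p.snd := Lp.coeFn_smul _ _
    have e1 : ∫ x in Ω, (c • p).fst x * fderiv ℝ φ x (EuclideanSpace.single i 1)
        = ∫ x in Ω, c * (p.fst x * fderiv ℝ φ x (EuclideanSpace.single i 1)) := by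
      refine integral_congr_ae ?_
      filter_upwards [h1] with x hx
      simp only [hx, Pi.smul_apply, smul_eq_mul, mul_assoc]
    have e2 : ∫ x in Ω, (c • p).snd x i * φ x = ∫ x in Ω, c * (p.snd x i * φ x) := by
      refine integral_congr_ae ?_
      filter_upwards [h2] with x hx
      simp only [hx, Pi.smul_apply, PiLp.smul_apply, smul_eq_mul, mul_assoc]
    rw [e1, e2, integral_const_mul, integral_const_mul, hp φ hφ i]
    ring

/-- `C₀^∞(Ω)` as a subspace of `H¹(Ω)`. -/
def testSubmodule {d : ℕ} (Ω : Set (EuclideanSpace ℝ (Fin d))) : Submodule ℝ (H1 Ω) where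
  carrier := {u | ∃ φ : EuclideanSpace ℝ (Fin d) → ℝ, IsTestFun Ω φ ∧
    (u : WithLp 2 (L2 Ω × L2Vec Ω)).fst =ᵐ[volume.restrict Ω] φ}
  zero_mem' := ⟨0, IsTestFun.zero, Lp.coeFn_zero _ _ _⟩
  add_mem' := by
    rintro u v ⟨φ, hφ, hu⟩ ⟨ψ, hψ, hv⟩
    exact ⟨φ + ψ, hφ.add hψ, (Lp.coeFn_add _ _).trans (hu.add hv)⟩
  smul_mem' := by
    rintro c u ⟨φ, hφ, hu⟩
    exact ⟨c • φ, hφ.const_smul c, (Lp.coeFn_smul _ _).trans (hu.const_smul c)⟩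

/-- `H¹₀(Ω)`: the closure of `C₀^∞(Ω)` in `H¹(Ω)`. As a type it carries the `H¹(Ω)` norm; the
norm `‖∇v‖_Ω` is always written out. -/
def H10 {d : ℕ} (Ω : Set (EuclideanSpace ℝ (Fin d))) : Type :=
  ↥(testSubmodule Ω).topologicalClosure

instance {d : ℕ} (Ω : Set (EuclideanSpace ℝ (Fin d))) : NormedAddCommGroup (H10 Ω) :=
  Submodule.normedAddCommGroup (testSubmodule Ω).topologicalClosure

instance {d : ℕ} (Ω : Set (EuclideanSpace ℝ (Fin d))) : InnerProductSpace ℝ (H10 Ω) :=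
  Submodule.innerProductSpace (testSubmodule Ω).topologicalClosure

/-- The inclusion `H¹₀(Ω) → H¹(Ω)`. -/
def H10.toH1 {d : ℕ} (Ω : Set (EuclideanSpace ℝ (Fin d))) : H10 Ω →L[ℝ] H1 Ω :=
  (testSubmodule Ω).topologicalClosure.subtypeL

/-- The inclusion `H¹₀(Ω) → L²(Ω)`. -/
def toL2 {d : ℕ} (Ω : Set (EuclideanSpace ℝ (Fin d))) : H10 Ω →L[ℝ] L2 Ω :=
  (WithLp.fstL 2 ℝ (L2 Ω) (L2Vec Ω)).comp ((H1 Ω).subtypeL.comp (H10.toH1 Ω))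

/-- The gradient `∇ : H¹₀(Ω) → L²(Ω; ℝᵈ)`. -/
def grad {d : ℕ} (Ω : Set (EuclideanSpace ℝ (Fin d))) : H10 Ω →L[ℝ] L2Vec Ω :=
  (WithLp.sndL 2 ℝ (L2 Ω) (L2Vec Ω)).comp ((H1 Ω).subtypeL.comp (H10.toH1 Ω))

/-- `H⁻¹(Ω)`, the space of continuous linear functionals on `H¹₀(Ω)`. -/
abbrev Hm1 {d : ℕ} (Ω : Set (EuclideanSpace ℝ (Fin d))) : Type := H10 Ω →L[ℝ] ℝ

/-- The dual norm `‖Φ‖_{H⁻¹(Ω)} = sup_{v ≠ 0} ⟨Φ, v⟩ / ‖∇v‖_Ω`. -/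
def normHm1 {d : ℕ} (Ω : Set (EuclideanSpace ℝ (Fin d))) (Φ : Hm1 Ω) : ℝ :=
  sSup {r : ℝ | ∃ v : H10 Ω, v ≠ 0 ∧ r = Φ v / ‖grad Ω v‖}

/-- The canonical embedding `L²(Ω) → H⁻¹(Ω)`, `⟨w, v⟩ = (w, v)_Ω`. -/
def embHm1 {d : ℕ} (Ω : Set (EuclideanSpace ℝ (Fin d))) (w : L2 Ω) : Hm1 Ω :=
  (innerSL ℝ w).comp (toL2 Ω)

/-! ### Bochner spaces -/

/-- `w` is the weak derivative of `f` on the interval `(0, T)`: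
`∫ f θ' = - ∫ w θ` for all `θ ∈ C₀^∞(0, T)`. -/
def HasWeakTimeDeriv {V : Type*} [NormedAddCommGroup V] [NormedSpace ℝ V]
    (T : ℝ) (f w : ℝ → V) : Prop :=
  ∀ θ : ℝ → ℝ, IsTestFun (Ioo 0 T) θ →
    ∫ t in Ioo 0 T, deriv θ t • f t = - ∫ t in Ioo 0 T, θ t • w t

/-- `L²(0, T; V)`. -/
abbrev L2Time (T : ℝ) (V : Type*) [NormedAddCommGroup V] : Type _ :=
  Lp V 2 (volume.restrict (Ioo 0 T))

/-- `X = L²(0, T; H¹₀(Ω))`. -/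
abbrev X {d : ℕ} (Ω : Set (EuclideanSpace ℝ (Fin d))) (T : ℝ) : Type := L2Time T (H10 Ω)

/-- `‖v‖_X = (∫₀ᵀ ‖∇v‖²_Ω dt)^{1/2}`. -/
def normX {d : ℕ} (Ω : Set (EuclideanSpace ℝ (Fin d))) (T : ℝ) (v : X Ω T) : ℝ :=
  Real.sqrt (∫ t in Ioo 0 T, ‖grad Ω (v t)‖ ^ 2)

/-- `w ∈ L²(0, T; H⁻¹(Ω))` is the weak time derivative of `φ ∈ X`, where `φ` is regarded as an
`H⁻¹(Ω)`-valued function. -/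
def IsTimeDeriv {d : ℕ} (Ω : Set (EuclideanSpace ℝ (Fin d))) (T : ℝ) (φ : X Ω T)
    (w : L2Time T (Hm1 Ω)) : Prop :=
  HasWeakTimeDeriv T (fun t => embHm1 Ω (toL2 Ω (φ t))) w

/-- `Y = L²(0, T; H¹₀(Ω)) ∩ H¹(0, T; H⁻¹(Ω))`. -/
def Y {d : ℕ} (Ω : Set (EuclideanSpace ℝ (Fin d))) (T : ℝ) : Set (X Ω T) :=
  {φ | ∃ w : L2Time T (Hm1 Ω), IsTimeDeriv Ω T φ w}

open Classical in
/-- The weak time derivative `∂ₜφ ∈ L²(0, T; H⁻¹(Ω))` of `φ ∈ Y` (and `0` if `φ ∉ Y`). -/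
def timeDeriv {d : ℕ} (Ω : Set (EuclideanSpace ℝ (Fin d))) (T : ℝ) (φ : X Ω T) :
    L2Time T (Hm1 Ω) :=
  if h : ∃ w : L2Time T (Hm1 Ω), IsTimeDeriv Ω T φ w then h.choose else 0

/-- `g ∈ C([0, T]; L²(Ω))` is a continuous representative of `φ`. -/
def IsContRep {d : ℕ} (Ω : Set (EuclideanSpace ℝ (Fin d))) (T : ℝ) (φ : X Ω T)
    (g : ℝ → L2 Ω) : Prop :=
  ContinuousOn g (Icc 0 T) ∧ ∀ᵐ t ∂(volume.restrict (Ioo 0 T)), g t = toL2 Ω (φ t)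

open Classical in
/-- The value `φ(s) ∈ L²(Ω)`, for `s ∈ [0, T]`, of the continuous representative of `φ`. It is
unique where it exists, and exists for every `φ ∈ Y` by the embedding `Y ⊂ C([0, T]; L²(Ω))`;
if there is none, the value is `0` by convention. -/
def valueAt {d : ℕ} (Ω : Set (EuclideanSpace ℝ (Fin d))) (T : ℝ) (φ : X Ω T) (s : ℝ) : L2 Ω :=
  if h : ∃ g : ℝ → L2 Ω, IsContRep Ω T φ g then h.choose s else 0

/-- `Y_T = {φ ∈ Y : φ(T) = 0}`. -/
def YT {d : ℕ} (Ω : Set (EuclideanSpace ℝ (Fin d))) (T : ℝ) : Set (X Ω T) :=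
  {φ | φ ∈ Y Ω T ∧ valueAt Ω T φ T = 0}

/-- `‖φ‖²_{Y_T} = ∫₀ᵀ (‖∂ₜφ‖²_{H⁻¹(Ω)} + ‖∇φ‖²_Ω) dt + ‖φ(0)‖²_Ω`. -/
def normYT {d : ℕ} (Ω : Set (EuclideanSpace ℝ (Fin d))) (T : ℝ) (φ : X Ω T) : ℝ :=
  Real.sqrt ((∫ t in Ioo 0 T, (normHm1 Ω (timeDeriv Ω T φ t) ^ 2 + ‖grad Ω (φ t)‖ ^ 2))
    + ‖valueAt Ω T φ 0‖ ^ 2)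

/-- `B_X(v, φ) = ∫₀ᵀ (-⟨∂ₜφ, v⟩ + (∇v, ∇φ)_Ω) dt`. -/
def BX {d : ℕ} (Ω : Set (EuclideanSpace ℝ (Fin d))) (T : ℝ) (v φ : X Ω T) : ℝ :=
  ∫ t in Ioo 0 T,
    (-(timeDeriv Ω T φ t (v t)) + inner ℝ (grad Ω (v t)) (grad Ω (φ t)))

end HeatSpaces

end

/-! Let `J` be the inverse of the Dirichlet Laplacian, so that `(∇JΦ, ∇v) = ⟨Φ, v⟩` (Poincaré and
Lax–Milgram), and attach to `φ ∈ Y_T` its residual `ρ = φ - J ∂ₜφ`. Then `B_X(v, φ) = ∫ (∇v, ∇ρ) dt`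
and `‖∂ₜφ‖_{H⁻¹} = ‖∇J∂ₜφ‖`. Expanding `∫ ‖∇ρ‖²` produces the cross term `-2 ∫ ⟨∂ₜφ, φ⟩ dt`, which
by the energy identity is `‖φ(0)‖² - ‖φ(T)‖² = ‖φ(0)‖²`; hence `‖φ‖_{Y_T} = ‖ρ‖_X`. The quotient in
the theorem is thus the Dirichlet inner product of `v` with `ρ`, divided by `‖ρ‖_X`. Cauchy–Schwarz
gives the upper bound, and equality follows once the residuals are dense in `X`.

Density (`residualSpace_orthogonal`) is uniqueness for the heat equation. If `z` is orthogonal to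
all residuals, set `f = Kz`, where `(∇Kx, ∇y) = (x, y)_{H¹}`. Testing with `θ(t)u(x)`, `θ(T) = 0`,
shows that `f` solves the heat equation with zero initial value, the latter because `θ(0)` is free.
The energy identity then forces `∇f = 0`, so `z = 0`.

The energy identity and the embedding `Y ⊂ C([0, T]; L²(Ω))` are proved for an injective `i : V → H`
between Hilbert spaces. The Riesz map turns the weak equation in the dual of `V` into `i†i f = c + ∫
w` in `V` (`HasWeakTimeDeriv.exists_eq_primitive`). The product rule for `(k, Qₙ k)`, with `k` this
primitive and `Qₙ = (i†i + 1/(n+1))⁻¹`, gives the identity in the limit, because `Qₙ i†i` are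
contractions tending strongly to the identity (`energy_identity_of_mem`,
`exists_continuous_representative`). -/

/-! ### Primitives of Bochner integrable functions -/

section Primitive

open Filter Topology

/-- A function whose increments are dominated by those of an absolutely continuous function is
absolutely continuous. -/
theorem AbsolutelyContinuousOnInterval.of_dist_le {X Y : Type*} [PseudoMetricSpace X]
    [PseudoMetricSpace Y] {f : ℝ → X} {g : ℝ → Y} {a b C : ℝ}
    (hg : AbsolutelyContinuousOnInterval g a b)
    (h : ∀ x ∈ uIcc a b, ∀ y ∈ uIcc a b, dist (f x) (f y) ≤ C * dist (g x) (g y)) :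
    AbsolutelyContinuousOnInterval f a b := by
  rw [absolutelyContinuousOnInterval_iff] at hg ⊢
  intro ε hε
  obtain ⟨δ, hδ, H⟩ := hg (ε / (|C| + 1)) (by positivity)
  refine ⟨δ, hδ, fun E hE hlt => ?_⟩
  have h1 := H E hE hlt
  calc ∑ i ∈ Finset.range E.1, dist (f (E.2 i).1) (f (E.2 i).2)
      ≤ ∑ i ∈ Finset.range E.1, (|C| + 1) * dist (g (E.2 i).1) (g (E.2 i).2) := by
        refine Finset.sum_le_sum fun i hi => ?_
        refine (h _ (hE.1 i hi).1 _ (hE.1 i hi).2).trans ?_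
        gcongr
        linarith [le_abs_self C]
    _ = (|C| + 1) * ∑ i ∈ Finset.range E.1, dist (g (E.2 i).1) (g (E.2 i).2) := by
        rw [Finset.mul_sum]
    _ < (|C| + 1) * (ε / (|C| + 1)) := by gcongr
    _ = ε := by field_simp

variable {E F G : Type*} [NormedAddCommGroup E] [NormedSpace ℝ E]
  [NormedAddCommGroup F] [NormedSpace ℝ F]
  [NormedAddCommGroup G] [NormedSpace ℝ G] {a b : ℝ}

/-- Any majorant `M` of `‖u‖` is allowed, so that the increments of several primitives can be
compared with those of one scalar absolutely continuous function. -/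
lemma dist_primitive_le {k u : ℝ → E} {M : ℝ → ℝ} (hu : IntervalIntegrable u volume a b)
    (hk : ∀ t ∈ uIcc a b, k t = k a + ∫ r in a..t, u r)
    (hM : IntervalIntegrable M volume a b) (huM : ∀ r, ‖u r‖ ≤ M r) {s t : ℝ}
    (hs : s ∈ uIcc a b) (ht : t ∈ uIcc a b) :
    ‖k t - k s‖ ≤ dist (∫ r in a..t, M r) (∫ r in a..s, M r) := by
  have sub : ∀ {x y}, x ∈ uIcc a b → y ∈ uIcc a b → uIcc x y ⊆ uIcc a b :=
    fun hx hy => uIcc_subset_uIcc hx hy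
  have ha : a ∈ uIcc a b := left_mem_uIcc
  rw [hk t ht, hk s hs, add_sub_add_left_eq_sub,
    intervalIntegral.integral_interval_sub_left (hu.mono_set (sub ha ht))
      (hu.mono_set (sub ha hs)), Real.dist_eq,
    intervalIntegral.integral_interval_sub_left (hM.mono_set (sub ha ht))
      (hM.mono_set (sub ha hs))]
  refine (intervalIntegral.norm_integral_le_abs_integral_norm).trans ?_
  rw [intervalIntegral.abs_intervalIntegral_eq, intervalIntegral.abs_intervalIntegral_eq]
  have h1 := (hu.norm.mono_set (sub hs ht)).def'
  have h2 := (hM.mono_set (sub hs ht)).def'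
  have hm := setIntegral_mono h1 h2 huM
  rw [abs_of_nonneg (integral_nonneg fun _ => norm_nonneg _)]
  exact hm.trans (le_abs_self _)

lemma continuousOn_of_eq_primitive {k u : ℝ → E} (hu : IntervalIntegrable u volume a b)
    (hk : ∀ t ∈ uIcc a b, k t = k a + ∫ r in a..t, u r) : ContinuousOn k (uIcc a b) := by
  refine (AbsolutelyContinuousOnInterval.of_dist_le (C := 1)
    (hu.norm.absolutelyContinuousOnInterval_intervalIntegral (c := a) left_mem_uIcc)
    fun x hx y hy => ?_).continuousOn
  rw [one_mul, dist_eq_norm]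
  exact dist_primitive_le hu hk hu.norm (fun _ => le_rfl) hy hx

lemma ae_hasDerivAt_of_eq_primitive [CompleteSpace E] {k u : ℝ → E}
    (hu : IntervalIntegrable u volume a b)
    (hk : ∀ t ∈ uIcc a b, k t = k a + ∫ r in a..t, u r) :
    ∀ᵐ x, x ∈ uIcc a b → HasDerivAt k (u x) x := by
  -- At the two endpoints `k` is known on one side only; they form a null set and are discarded.
  have h₁ : ∀ᵐ x : ℝ, x ≠ min a b := by simp [ae_iff, measure_singleton]
  have h₂ : ∀ᵐ x : ℝ, x ≠ max a b := by simp [ae_iff, measure_singleton]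
  filter_upwards [hu.ae_hasDerivAt_integral, h₁, h₂] with x hx h1 h2 hxm
  refine ((hx hxm a left_mem_uIcc).const_add (k a)).congr_of_eventuallyEq ?_
  have : Icc (min a b) (max a b) ∈ 𝓝 x :=
    Icc_mem_nhds (lt_of_le_of_ne hxm.1 (Ne.symm h1)) (lt_of_le_of_ne hxm.2 h2)
  filter_upwards [this] with y hy using hk y hy

/-- The product rule, in integrated form, for a continuous bilinear map applied to two
primitives. -/
theorem bilinear_primitive_sub [CompleteSpace E] [CompleteSpace F] [CompleteSpace G]
    (B : E →L[ℝ] F →L[ℝ] G) {k u : ℝ → E} {l w : ℝ → F}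
    (hu : IntervalIntegrable u volume a b) (hk : ∀ t ∈ uIcc a b, k t = k a + ∫ r in a..t, u r)
    (hw : IntervalIntegrable w volume a b) (hl : ∀ t ∈ uIcc a b, l t = l a + ∫ r in a..t, w r)
    {s t : ℝ} (hs : s ∈ uIcc a b) (ht : t ∈ uIcc a b) :
    IntervalIntegrable (fun r => B (u r) (l r) + B (k r) (w r)) volume a b ∧
    B (k t) (l t) - B (k s) (l s) = ∫ r in s..t, (B (u r) (l r) + B (k r) (w r)) := by
  have kc := continuousOn_of_eq_primitive hu hk
  have lc := continuousOn_of_eq_primitive hw hl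
  obtain ⟨K, hK⟩ := isCompact_uIcc.exists_bound_of_continuousOn kc
  obtain ⟨L, hL⟩ := isCompact_uIcc.exists_bound_of_continuousOn lc
  have mono : uIoc a b ⊆ uIcc a b := uIoc_subset_uIcc
  have i1 : IntervalIntegrable (fun r => B (u r) (l r)) volume a b := by
    rw [intervalIntegrable_iff] at hu ⊢
    refine (hu.norm.const_mul (‖B‖ * L)).mono' (B.aestronglyMeasurable_comp₂ hu.1
      ((lc.mono mono).aestronglyMeasurable measurableSet_uIoc)) ?_
    filter_upwards [ae_restrict_mem measurableSet_uIoc] with r hr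
    refine (B.le_opNorm₂ _ _).trans ?_
    rw [mul_right_comm]
    gcongr
    exact hL r (mono hr)
  have i2 : IntervalIntegrable (fun r => B (k r) (w r)) volume a b := by
    rw [intervalIntegrable_iff] at hw ⊢
    refine (hw.norm.const_mul (‖B‖ * K)).mono' (B.aestronglyMeasurable_comp₂
      ((kc.mono mono).aestronglyMeasurable measurableSet_uIoc) hw.1) ?_
    filter_upwards [ae_restrict_mem measurableSet_uIoc] with r hr
    refine (B.le_opNorm₂ _ _).trans ?_
    gcongr
    exact hK r (mono hr)
  set p : ℝ → G := fun r => B (u r) (l r) + B (k r) (w r) with hp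
  have ip : IntervalIntegrable p volume a b := i1.add i2
  refine ⟨ip, ?_⟩
  set M : ℝ → ℝ := fun r => ‖u r‖ + ‖w r‖ + ‖p r‖
  have iM : IntervalIntegrable M volume a b := (hu.norm.add hw.norm).add ip.norm
  set q : ℝ → G := fun t => ∫ r in a..t, p r with hq
  have hq' : ∀ t ∈ uIcc a b, q t = q a + ∫ r in a..t, p r := fun t _ => by simp [hq]
  -- The product minus the primitive of its expected derivative is absolutely continuous with
  -- derivative zero almost everywhere, hence constant.
  set D : ℝ → G := fun t => B (k t) (l t) - q t with hD
  have hK0 : 0 ≤ K := (norm_nonneg _).trans (hK a left_mem_uIcc)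
  have hL0 : 0 ≤ L := (norm_nonneg _).trans (hL a left_mem_uIcc)
  have Dac : AbsolutelyContinuousOnInterval D a b := by
    refine AbsolutelyContinuousOnInterval.of_dist_le (C := ‖B‖ * L + ‖B‖ * K + 1)
      (iM.absolutelyContinuousOnInterval_intervalIntegral (c := a) left_mem_uIcc)
      fun x hx y hy => ?_
    set d := dist (∫ r in a..x, M r) (∫ r in a..y, M r)
    have e1 : ‖k x - k y‖ ≤ d := dist_primitive_le hu hk iM
      (fun r => by simp only [M]; linarith [norm_nonneg (w r), norm_nonneg (p r)]) hy hx
    have e2 : ‖l x - l y‖ ≤ d := dist_primitive_le hw hl iM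
      (fun r => by simp only [M]; linarith [norm_nonneg (u r), norm_nonneg (p r)]) hy hx
    have e3 : ‖q x - q y‖ ≤ d := dist_primitive_le ip hq' iM
      (fun r => by simp only [M]; linarith [norm_nonneg (u r), norm_nonneg (w r)]) hy hx
    have eq : D x - D y = B (k x - k y) (l x) + B (k y) (l x - l y) - (q x - q y) := by
      simp only [hD, map_sub, sub_apply]; abel
    rw [dist_eq_norm, eq]
    refine (norm_sub_le _ _).trans ?_
    have n1 : ‖B (k x - k y) (l x)‖ ≤ ‖B‖ * d * L :=
      (B.le_opNorm₂ _ _).trans (by gcongr; exact hL x hx)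
    have n2 : ‖B (k y) (l x - l y)‖ ≤ ‖B‖ * K * d :=
      (B.le_opNorm₂ _ _).trans (by gcongr; exact hK y hy)
    have := norm_add_le (B (k x - k y) (l x)) (B (k y) (l x - l y))
    nlinarith
  have D0 : ∀ᵐ x, x ∈ uIcc a b → HasDerivAt D 0 x := by
    filter_upwards [ae_hasDerivAt_of_eq_primitive hu hk, ae_hasDerivAt_of_eq_primitive hw hl,
      ae_hasDerivAt_of_eq_primitive ip hq'] with x h1 h2 h3 hx
    have := (B.hasFDerivAt_of_bilinear (h1 hx).hasFDerivAt (h2 hx).hasFDerivAt).hasDerivAt.sub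
      (h3 hx)
    convert! this using 1
    simp [hp, add_comm]
  obtain ⟨C, hC⟩ := Dac.const_of_ae_hasDerivAt_zero D0
  have h3 : q t - q s = ∫ r in s..t, p r := by
    simp only [hq]
    exact intervalIntegral.integral_interval_sub_left
      (ip.mono_set (uIcc_subset_uIcc left_mem_uIcc ht))
      (ip.mono_set (uIcc_subset_uIcc left_mem_uIcc hs))
  rw [← h3]
  have h1 := hC t ht
  have h2 := hC s hs
  simp only [hD] at h1 h2
  rw [← sub_eq_zero, ← sub_eq_zero.mpr (h1.trans h2.symm)]
  abel

/-- Integration by parts of a primitive against a smooth function. -/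
theorem integral_deriv_smul_primitive [CompleteSpace E] {k u : ℝ → E}
    (hu : IntervalIntegrable u volume a b) (hk : ∀ t ∈ uIcc a b, k t = k a + ∫ r in a..t, u r)
    {θ : ℝ → ℝ} (hθ : ContDiff ℝ 1 θ) :
    ∫ r in a..b, deriv θ r • k r = θ b • k b - θ a • k a - ∫ r in a..b, θ r • u r := by
  have hc : Continuous (deriv θ) := hθ.continuous_deriv le_rfl
  have hd : IntervalIntegrable (deriv θ) volume a b := hc.intervalIntegrable _ _
  have hθp : ∀ t ∈ uIcc a b, θ t = θ a + ∫ r in a..t, deriv θ r := fun t _ => by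
    rw [intervalIntegral.integral_deriv_eq_sub
      (fun x _ => (hθ.differentiable (by simp)).differentiableAt) (hc.intervalIntegrable _ _)]
    ring
  have h := (bilinear_primitive_sub (ContinuousLinearMap.lsmul ℝ ℝ) hd hθp hu hk
    left_mem_uIcc right_mem_uIcc).2
  simp only [ContinuousLinearMap.lsmul_apply] at h
  have kc := continuousOn_of_eq_primitive hu hk
  have i1 : IntervalIntegrable (fun r => deriv θ r • k r) volume a b :=
    (hc.continuousOn.smul kc).intervalIntegrable
  rw [intervalIntegral.integral_add i1 (hu.continuousOn_smul hθ.continuous.continuousOn)] at h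
  rw [h]; abel

end Primitive

namespace HeatSpaces

/-! ### Weak time derivatives -/

section WeakTimeDeriv

variable {E F : Type*} [NormedAddCommGroup E] [NormedSpace ℝ E]
  [NormedAddCommGroup F] [NormedSpace ℝ F] {T : ℝ}

lemma setIntegral_Ioo_eq_intervalIntegral (hT : 0 ≤ T) (f : ℝ → E) :
    ∫ t in Ioo 0 T, f t = ∫ t in (0 : ℝ)..T, f t := by
  rw [intervalIntegral.integral_of_le hT, integral_Ioc_eq_integral_Ioo]

lemma intervalIntegrable_of_integrable_Ioo {E : Type*} [NormedAddCommGroup E] (hT : 0 ≤ T)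
    {f : ℝ → E}
    (hf : Integrable f (volume.restrict (Ioo 0 T))) : IntervalIntegrable f volume 0 T :=
  (intervalIntegrable_iff_integrableOn_Ioo_of_le hT).2 hf

lemma IsTestFun.eq_zero {S : Set E} {θ : E → ℝ} (hθ : IsTestFun S θ) {t : E} (ht : t ∉ S) :
    θ t = 0 :=
  image_eq_zero_of_notMem_tsupport fun h => ht (hθ.tsupport_subset h)

lemma IsTestFun.exists_Icc (hT : 0 < T) {θ : ℝ → ℝ} (hθ : IsTestFun (Ioo 0 T) θ) :
    ∃ a b, 0 < a ∧ a ≤ b ∧ b < T ∧ tsupport θ ⊆ Icc a b := by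
  -- Adjoining the midpoint keeps the compact set nonempty when `θ = 0`.
  have hc : IsCompact (insert (T / 2) (tsupport θ)) := hθ.hasCompactSupport.isCompact.insert _
  have hne : (insert (T / 2) (tsupport θ)).Nonempty := insert_nonempty _ _
  have hsub : insert (T / 2) (tsupport θ) ⊆ Ioo 0 T :=
    insert_subset ⟨by linarith, by linarith⟩ hθ.tsupport_subset
  obtain ⟨a, ha, ha'⟩ := hc.exists_isLeast hne
  obtain ⟨b, hb, hb'⟩ := hc.exists_isGreatest hne
  exact ⟨a, b, (hsub ha).1, ha' hb, (hsub hb).2,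
    fun x hx => ⟨ha' (mem_insert_of_mem _ hx), hb' (mem_insert_of_mem _ hx)⟩⟩

lemma exists_isTestFun_integral_eq_one (hT : 0 < T) :
    ∃ ρ : ℝ → ℝ, IsTestFun (Ioo 0 T) ρ ∧ ∫ t in (0 : ℝ)..T, ρ t = 1 := by
  let f : ContDiffBump (T / 2) := ⟨T / 8, T / 4, by linarith, by linarith⟩
  have hs : tsupport (f.normed volume) ⊆ Ioo 0 T := by
    rw [f.tsupport_normed_eq, Real.closedBall_eq_Icc]
    intro x hx
    have hr : f.rOut = T / 4 := rfl
    exact ⟨by linarith [hx.1], by linarith [hx.2]⟩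
  have ht : IsTestFun (Ioo 0 T) (f.normed volume) :=
    ⟨f.contDiff_normed, f.hasCompactSupport_normed, hs⟩
  refine ⟨_, ht, ?_⟩
  rw [← setIntegral_Ioo_eq_intervalIntegral hT.le, setIntegral_eq_integral_of_forall_compl_eq_zero
    fun t h => ht.eq_zero h, f.integral_normed]

/-- A test function of mean zero is the derivative of a test function. -/
lemma IsTestFun.exists_primitive (hT : 0 < T) {η : ℝ → ℝ} (hη : IsTestFun (Ioo 0 T) η)
    (h0 : ∫ t in (0 : ℝ)..T, η t = 0) : ∃ θ, IsTestFun (Ioo 0 T) θ ∧ deriv θ = η := by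
  obtain ⟨a, b, ha, hab, hb, hsub⟩ := hη.exists_Icc hT
  have hc : Continuous η := hη.contDiff.continuous
  have hz : ∀ t, t ∉ Icc a b → η t = 0 := fun t ht =>
    image_eq_zero_of_notMem_tsupport fun h => ht (hsub h)
  set θ : ℝ → ℝ := fun t => ∫ r in (0 : ℝ)..t, η r with hθ
  have hder : ∀ t, HasDerivAt θ (η t) t := fun t =>
    intervalIntegral.integral_hasDerivAt_right (hc.intervalIntegrable _ _)
      (hc.stronglyMeasurableAtFilter _ _) hc.continuousAt
  have hd : deriv θ = η := funext fun t => (hder t).deriv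
  have hsupp : ∀ t, t ∉ Icc a b → θ t = 0 := by
    intro t ht
    -- To the left of `[a, b]` the integrand vanishes up to `t`; to the right, mean zero replaces
    -- the integral by minus the one over `[t, T]`.
    rcases not_and_or.1 ht with h | h
    · refine intervalIntegral.integral_zero_ae (Filter.Eventually.of_forall fun r hr => hz r ?_)
      intro hr'
      have := hr.2
      rcases max_cases 0 t with ⟨h1, _⟩ | ⟨h1, _⟩ <;> rw [h1] at this <;> linarith [hr'.1]
    · have e : θ t + ∫ r in t..T, η r = 0 := by
        rw [← h0]
        exact intervalIntegral.integral_add_adjacent_intervals (hc.intervalIntegrable _ _)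
          (hc.intervalIntegrable _ _)
      rw [← e, intervalIntegral.integral_zero_ae, add_zero]
      refine Filter.Eventually.of_forall fun r hr => hz r ?_
      intro hr'
      have := hr.1
      rcases min_cases t T with ⟨h1, _⟩ | ⟨h1, _⟩ <;> rw [h1] at this <;> linarith [hr'.2]
  have hts : tsupport θ ⊆ Icc a b :=
    closure_minimal (fun t ht => by by_contra h; exact ht (hsupp t h)) isClosed_Icc
  refine ⟨θ, ⟨?_, isCompact_Icc.of_isClosed_subset (isClosed_tsupport θ) hts, ?_⟩, hd⟩
  · exact contDiff_infty_iff_deriv.2 ⟨fun t => (hder t).differentiableAt, hd ▸ hη.contDiff⟩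
  · exact hts.trans fun x hx => ⟨ha.trans_le hx.1, hx.2.trans_lt hb⟩

lemma integrable_continuous_smul {θ : ℝ → ℝ} (hθ : Continuous θ)
    {f : ℝ → E} (hf : Integrable f (volume.restrict (Ioo 0 T))) :
    Integrable (fun t => θ t • f t) (volume.restrict (Ioo 0 T)) := by
  obtain ⟨C, hC⟩ := (isCompact_Icc (a := (0 : ℝ)) (b := T)).exists_bound_of_continuousOn
    hθ.continuousOn
  refine (hf.norm.const_mul C).mono' (hθ.aestronglyMeasurable.smul hf.1) ?_
  filter_upwards [ae_restrict_mem measurableSet_Ioo] with t ht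
  rw [norm_smul]
  gcongr
  exact hC t (Ioo_subset_Icc_self ht)

/-- The du Bois-Reymond lemma. -/
theorem HasWeakTimeDeriv.exists_eq_primitive [CompleteSpace E] (hT : 0 < T) {f w : ℝ → E}
    (hf : Integrable f (volume.restrict (Ioo 0 T)))
    (hw : Integrable w (volume.restrict (Ioo 0 T))) (h : HasWeakTimeDeriv T f w) :
    ∃ c, ∀ᵐ t ∂volume.restrict (Ioo 0 T), f t = c + ∫ r in (0 : ℝ)..t, w r := by
  have iw := intervalIntegrable_of_integrable_Ioo hT.le hw
  set W : ℝ → E := fun t => ∫ r in (0 : ℝ)..t, w r with hW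
  have hWp : ∀ t ∈ uIcc 0 T, W t = W 0 + ∫ r in (0 : ℝ)..t, w r := fun t _ => by simp [hW]
  have Wc : ContinuousOn W (Icc 0 T) := by
    rw [← uIcc_of_le hT.le]; exact continuousOn_of_eq_primitive iw hWp
  have Wi : Integrable W (volume.restrict (Ioo 0 T)) :=
    (Wc.integrableOn_Icc).mono_set Ioo_subset_Icc_self
  set g : ℝ → E := fun t => f t - W t with hg
  have gi : Integrable g (volume.restrict (Ioo 0 T)) := hf.sub Wi
  have g0 : ∀ θ, IsTestFun (Ioo 0 T) θ → ∫ t in Ioo 0 T, deriv θ t • g t = 0 := by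
    intro θ hθ
    have hc1 : ContDiff ℝ 1 θ := hθ.contDiff.of_le (by simp)
    have hdc : Continuous (deriv θ) := hc1.continuous_deriv le_rfl
    simp only [hg, smul_sub]
    rw [integral_sub (integrable_continuous_smul hdc hf) (integrable_continuous_smul hdc Wi), h θ hθ,
      setIntegral_Ioo_eq_intervalIntegral hT.le, setIntegral_Ioo_eq_intervalIntegral hT.le,
      integral_deriv_smul_primitive iw hWp hc1, hθ.eq_zero (t := T) (by simp),
      hθ.eq_zero (t := 0) (by simp)]
    simp
  obtain ⟨ρ, hρ, hρ1⟩ := exists_isTestFun_integral_eq_one hT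
  -- If `g` is constant, then its value is this one, because `ρ` has integral one.
  set c := ∫ t in Ioo 0 T, ρ t • g t with hc
  refine ⟨c, ?_⟩
  have key : ∀ᵐ t, t ∈ Ioo 0 T → g t - c = 0 := by
    refine isOpen_Ioo.ae_eq_zero_of_integral_contDiff_smul_eq_zero
      (IntegrableOn.locallyIntegrableOn (gi.sub (integrable_const c))) fun ψ h1 h2 h3 => ?_
    have hψ : IsTestFun (Ioo 0 T) ψ := ⟨h1, h2, h3⟩
    set m := ∫ t in (0 : ℝ)..T, ψ t with hm
    -- Subtracting `m ρ` from `ψ` makes the mean zero, so the result is `deriv θ` for a test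
    -- function `θ` and `g0` applies.
    have hη : IsTestFun (Ioo 0 T) (ψ + (-m) • ρ) := hψ.add (hρ.const_smul _)
    obtain ⟨θ, hθ, hθ'⟩ := hη.exists_primitive hT (by
      simp only [Pi.add_apply, Pi.smul_apply, smul_eq_mul]
      rw [intervalIntegral.integral_add (h1.continuous.intervalIntegrable _ _)
        ((hρ.contDiff.continuous.intervalIntegrable _ _).const_mul _),
        intervalIntegral.integral_const_mul, hρ1, ← hm]
      ring)
    have e := g0 θ hθ
    rw [hθ'] at e
    simp only [Pi.add_apply, Pi.smul_apply, smul_eq_mul, add_smul, mul_smul] at e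
    have iρ : Integrable (fun t => -m • ρ t • g t) (volume.restrict (Ioo 0 T)) :=
      (integrable_continuous_smul hρ.contDiff.continuous gi).smul (-m)
    rw [integral_add (integrable_continuous_smul h1.continuous gi) iρ, integral_smul, ← hc] at e
    rw [← setIntegral_eq_integral_of_forall_compl_eq_zero (s := Ioo 0 T)
      fun t ht => by rw [hψ.eq_zero ht, zero_smul]]
    simp only [smul_sub]
    rw [integral_sub (integrable_continuous_smul h1.continuous gi)
      (integrable_continuous_smul h1.continuous (integrable_const c)), integral_smul_const,
      setIntegral_Ioo_eq_intervalIntegral hT.le ψ, ← hm, sub_eq_add_neg, ← neg_smul]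
    exact e
  rw [ae_restrict_iff' measurableSet_Ioo]
  filter_upwards [key] with t ht hmem
  have := ht hmem
  simp only [hg] at this
  rw [sub_sub, sub_eq_zero] at this
  rw [this, add_comm]

theorem HasWeakTimeDeriv.ae_unique [CompleteSpace E] {f w w' : ℝ → E}
    (hw : Integrable w (volume.restrict (Ioo 0 T)))
    (hw' : Integrable w' (volume.restrict (Ioo 0 T)))
    (h : HasWeakTimeDeriv T f w) (h' : HasWeakTimeDeriv T f w') :
    w =ᵐ[volume.restrict (Ioo 0 T)] w' := by
  rw [Filter.EventuallyEq, ae_restrict_iff' measurableSet_Ioo]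
  have := isOpen_Ioo.ae_eq_zero_of_integral_contDiff_smul_eq_zero (U := Ioo 0 T)
      (IntegrableOn.locallyIntegrableOn (hw.sub hw')) fun ψ h1 h2 h3 => by
    have hψ : IsTestFun (Ioo 0 T) ψ := ⟨h1, h2, h3⟩
    rw [← setIntegral_eq_integral_of_forall_compl_eq_zero (s := Ioo 0 T)
      fun t ht => by rw [hψ.eq_zero ht, zero_smul]]
    simp only [Pi.sub_apply, smul_sub]
    rw [integral_sub (integrable_continuous_smul h1.continuous hw)
      (integrable_continuous_smul h1.continuous hw'), sub_eq_zero, ← neg_inj, ← h ψ hψ, ← h' ψ hψ]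
  filter_upwards [this] with t ht hm using sub_eq_zero.1 (ht hm)

theorem HasWeakTimeDeriv.clm_comp [CompleteSpace E] [CompleteSpace F] (A : E →L[ℝ] F)
    {f w : ℝ → E}
    (hf : Integrable f (volume.restrict (Ioo 0 T)))
    (hw : Integrable w (volume.restrict (Ioo 0 T))) (h : HasWeakTimeDeriv T f w) :
    HasWeakTimeDeriv T (fun t => A (f t)) (fun t => A (w t)) := by
  intro θ hθ
  have hdc : Continuous (deriv θ) := hθ.contDiff.continuous_deriv (by simp)
  have := congrArg A (h θ hθ)
  rw [map_neg, ← A.integral_comp_comm (integrable_continuous_smul hdc hf),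
    ← A.integral_comp_comm (integrable_continuous_smul hθ.contDiff.continuous hw)] at this
  simpa only [map_smul] using this

end WeakTimeDeriv

/-! ### The energy identity in a Gelfand triple -/

section Energy

open Filter Topology InnerProductSpace

variable {V H : Type*} [NormedAddCommGroup V] [InnerProductSpace ℝ V] [CompleteSpace V]
  [NormedAddCommGroup H] [InnerProductSpace ℝ H] [CompleteSpace H]

/-- The real inner product as a continuous bilinear map. -/
noncomputable def innerBilin (V : Type*) [NormedAddCommGroup V] [InnerProductSpace ℝ V] : V →L[ℝ] V →L[ℝ] ℝ :=
  (isBoundedBilinearMap_inner (𝕜 := ℝ) (E := V)).toContinuousLinearMap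

@[simp] lemma innerBilin_apply (V : Type*) [NormedAddCommGroup V] [InnerProductSpace ℝ V]
    (x y : V) : innerBilin V x y = inner ℝ x y := rfl

/-- The operator `i† ∘ i` on `V` attached to a continuous linear map `i : V → H`. -/
noncomputable def gramOp (i : V →L[ℝ] H) : V →L[ℝ] V := (ContinuousLinearMap.adjoint i).comp i

lemma inner_gramOp (i : V →L[ℝ] H) (x y : V) : inner ℝ (gramOp i x) y = inner ℝ (i x) (i y) := by
  simp [gramOp, ContinuousLinearMap.adjoint_inner_left]

lemma gramOp_symm (i : V →L[ℝ] H) (x y : V) :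
    inner ℝ (gramOp i x) y = inner ℝ x (gramOp i y) := by
  rw [inner_gramOp, real_inner_comm, ← inner_gramOp, real_inner_comm]

/-- A vector `x` orthogonal to the range is orthogonal to `i†i x`, so `‖i x‖² = 0` and injectivity
gives `x = 0`. -/
lemma dense_range_gramOp {i : V →L[ℝ] H} (hi : Function.Injective i) :
    DenseRange (gramOp i) := by
  have h : (gramOp i).range.topologicalClosure = ⊤ := by
    rw [Submodule.topologicalClosure_eq_top_iff, Submodule.eq_bot_iff]
    intro x hx
    have h1 : inner ℝ (gramOp i x) x = 0 := hx _ ⟨x, rfl⟩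
    rw [inner_gramOp, real_inner_self_eq_norm_sq, sq_eq_zero_iff, norm_eq_zero] at h1
    exact hi (by rw [h1, map_zero])
  intro x
  have : x ∈ (gramOp i).range.topologicalClosure := h ▸ Submodule.mem_top
  rwa [← SetLike.mem_coe, Submodule.topologicalClosure_coe] at this

/-- The resolvent `(i† i + ε)⁻¹`. -/
lemma exists_resolvent (i : V →L[ℝ] H) {ε : ℝ} (hε : 0 < ε) :
    ∃ Q : V →L[ℝ] V, (∀ x, Q (gramOp i x) + ε • Q x = x) ∧
      (∀ x, gramOp i (Q x) + ε • Q x = x) ∧ ∀ x y, inner ℝ (Q x) y = inner ℝ x (Q y) := by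
  set S : V →L[ℝ] V := gramOp i + ε • ContinuousLinearMap.id ℝ V
  have hS : ∀ x, S x = gramOp i x + ε • x := fun x => rfl
  have hco : IsCoercive ((innerBilin V).comp S) := by
    refine ⟨ε, hε, fun u => ?_⟩
    simp only [ContinuousLinearMap.comp_apply, innerBilin_apply, hS, inner_add_left, inner_gramOp,
      real_inner_smul_left, real_inner_self_eq_norm_sq]
    nlinarith [sq_nonneg ‖i u‖]
  set e := hco.continuousLinearEquivOfBilin
  have he : ∀ x, e x = S x := fun x =>
    (hco.unique_continuousLinearEquivOfBilin fun w => by simp).symm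
  have h2 : ∀ x, gramOp i (e.symm x) + ε • e.symm x = x := fun x => by
    rw [← hS, ← he, e.apply_symm_apply]
  refine ⟨e.symm, fun x => ?_, h2, fun x y => ?_⟩
  · have := e.symm_apply_apply x
    rwa [he, hS, map_add, map_smul] at this
  · conv_lhs => rw [← h2 y]
    conv_rhs => rw [← h2 x]
    simp only [inner_add_left, inner_add_right, real_inner_smul_left, real_inner_smul_right,
      ContinuousLinearEquiv.coe_coe, gramOp_symm]

/-- For `y = Q i†i x` one has `i†i (x - y) = ε y`. Positivity of `i†i` at `x - y` gives `⟨y, x - y⟩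
≥ 0`, that is, `‖y‖² ≤ ⟨y, x⟩`. -/
lemma norm_resolvent_gramOp_le (i : V →L[ℝ] H) {ε : ℝ} (hε : 0 < ε) {Q : V →L[ℝ] V}
    (hQ : ∀ x, gramOp i (Q x) + ε • Q x = x) (x : V) :
    ‖Q (gramOp i x)‖ ≤ ‖x‖ := by
  set y := Q (gramOp i x)
  have h1 : gramOp i (x - y) = ε • y := by
    rw [map_sub, sub_eq_iff_eq_add, add_comm]; exact (hQ _).symm
  have h2 : 0 ≤ inner ℝ (gramOp i (x - y)) (x - y) := by
    rw [inner_gramOp]; exact real_inner_self_nonneg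
  rw [h1, real_inner_smul_left, inner_sub_right, real_inner_self_eq_norm_sq] at h2
  have h3 : ‖y‖ ^ 2 ≤ ‖y‖ * ‖x‖ := by
    have := nonneg_of_mul_nonneg_right h2 hε
    linarith [real_inner_le_norm y x]
  rcases (norm_nonneg y).eq_or_lt with h | h
  · rw [← h]; exact norm_nonneg x
  · rw [sq] at h3; exact le_of_mul_le_mul_left h3 h

/-- There is a sequence of bounded symmetric operators `Q n` such that `Q n ∘ (i† i)` are
contractions converging strongly to the identity. -/
lemma exists_approx_inverse {i : V →L[ℝ] H} (hi : Function.Injective i) :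
    ∃ Q : ℕ → V →L[ℝ] V, (∀ n x y, inner ℝ (Q n x) y = inner ℝ x (Q n y)) ∧
      (∀ n x, ‖Q n (gramOp i x)‖ ≤ ‖x‖) ∧
      ∀ x, Tendsto (fun n => Q n (gramOp i x)) atTop (𝓝 x) := by
  choose Q h1 h2 h3 using fun n : ℕ => exists_resolvent i (Nat.one_div_pos_of_nat (α := ℝ) (n := n))
  have hle : ∀ n x, ‖Q n (gramOp i x)‖ ≤ ‖x‖ := fun n x =>
    norm_resolvent_gramOp_le i Nat.one_div_pos_of_nat (h2 n) x
  refine ⟨Q, h3, hle, fun x => ?_⟩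
  rw [Metric.tendsto_atTop]
  intro η hη
  -- On a vector `i†i z` the error is `Qₙ i†i z / (n + 1)` up to sign, of norm at most `‖z‖ / (n +
  -- 1)`. Such vectors are dense, and the uniform contraction bound carries the convergence over to
  -- `x`.
  obtain ⟨z, hz⟩ := (dense_range_gramOp hi).exists_dist_lt x (show 0 < η / 4 by positivity)
  have hlim : Tendsto (fun n : ℕ => 1 / ((n : ℝ) + 1) * ‖z‖) atTop (𝓝 0) := by
    simpa using tendsto_one_div_add_atTop_nhds_zero_nat.mul_const ‖z‖
  obtain ⟨N, hN⟩ := Metric.tendsto_atTop.1 hlim (η / 4) (by positivity)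
  refine ⟨N, fun n hn => ?_⟩
  have e1 : ‖Q n (gramOp i (x - gramOp i z))‖ ≤ ‖x - gramOp i z‖ := hle _ _
  have e2 : ‖Q n (gramOp i (gramOp i z)) - gramOp i z‖ < η / 4 := by
    have : Q n (gramOp i (gramOp i z)) - gramOp i z
        = -((1 / ((n : ℝ) + 1)) • Q n (gramOp i z)) := by
      rw [sub_eq_iff_eq_add, neg_add_eq_sub, eq_sub_iff_add_eq]; exact h1 n _
    rw [this, norm_neg, norm_smul, Real.norm_of_nonneg Nat.one_div_pos_of_nat.le]
    refine lt_of_le_of_lt (mul_le_mul_of_nonneg_left (hle n z) Nat.one_div_pos_of_nat.le) ?_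
    have := hN n hn
    rw [Real.dist_eq, sub_zero] at this
    exact (le_abs_self _).trans_lt this
  rw [dist_eq_norm] at hz ⊢
  have e3 : Q n (gramOp i x) - x = Q n (gramOp i (x - gramOp i z))
      + (Q n (gramOp i (gramOp i z)) - gramOp i z) - (x - gramOp i z) := by
    simp only [map_sub]; abel
  rw [e3]
  have := norm_sub_le (Q n (gramOp i (x - gramOp i z))
      + (Q n (gramOp i (gramOp i z)) - gramOp i z)) (x - gramOp i z)
  have := norm_add_le (Q n (gramOp i (x - gramOp i z)))
    (Q n (gramOp i (gramOp i z)) - gramOp i z)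
  linarith

variable {T : ℝ} {f w : ℝ → V} {c : V}

lemma uIcc_subset_Ioo {s t : ℝ} (hs : s ∈ Ioo 0 T) (ht : t ∈ Ioo 0 T) : uIcc s t ⊆ Ioo 0 T :=
  ordConnected_Ioo.uIcc_subset hs ht

lemma intervalIntegrable_of_memLp {V : Type*} [NormedAddCommGroup V] {w : ℝ → V} (hw : MemLp w 2 (volume.restrict (Ioo 0 T))) (hT : 0 ≤ T) :
    IntervalIntegrable w volume 0 T :=
  intervalIntegrable_of_integrable_Ioo hT (hw.integrable (by norm_num))

lemma integrable_inner_of_memLp {α V : Type*} [NormedAddCommGroup V] [InnerProductSpace ℝ V]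
    {_ : MeasurableSpace α} {μ : Measure α} {f g : α → V} (hf : MemLp f 2 μ) (hg : MemLp g 2 μ) :
    Integrable (fun x => inner ℝ (f x) (g x)) μ :=
  (hf.norm.integrable_mul hg.norm).mono' (hf.1.inner hg.1)
    (Eventually.of_forall fun _ => norm_inner_le_norm _ _)

/-- The energy identity, at almost all pairs of times. -/
theorem energy_identity_of_mem (hT : 0 ≤ T) {i : V →L[ℝ] H} (hi : Function.Injective i)
    (hf : MemLp f 2 (volume.restrict (Ioo 0 T))) (hw : MemLp w 2 (volume.restrict (Ioo 0 T)))
    (hk : ∀ᵐ t ∂volume.restrict (Ioo 0 T), gramOp i (f t) = c + ∫ r in (0 : ℝ)..t, w r)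
    {s t : ℝ} (hs : s ∈ Ioo 0 T) (ht : t ∈ Ioo 0 T)
    (hks : gramOp i (f s) = c + ∫ r in (0 : ℝ)..s, w r)
    (hkt : gramOp i (f t) = c + ∫ r in (0 : ℝ)..t, w r) :
    ‖i (f t)‖ ^ 2 - ‖i (f s)‖ ^ 2 = ∫ r in s..t, 2 * inner ℝ (w r) (f r) := by
  obtain ⟨Q, hsym, hle, hlim⟩ := exists_approx_inverse hi
  set k : ℝ → V := fun t => c + ∫ r in (0 : ℝ)..t, w r with hkdef
  have iw := intervalIntegrable_of_memLp hw hT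
  have hkp : ∀ t ∈ uIcc 0 T, k t = k 0 + ∫ r in (0 : ℝ)..t, w r := fun t _ => by simp [hkdef]
  have hs' : s ∈ uIcc 0 T := Ioo_subset_Icc_self.trans Icc_subset_uIcc hs
  have ht' : t ∈ uIcc 0 T := Ioo_subset_Icc_self.trans Icc_subset_uIcc ht
  have hsub : uIoc s t ⊆ Ioo 0 T := uIoc_subset_uIcc.trans (uIcc_subset_Ioo hs ht)
  have hk' : ∀ᵐ r, r ∈ uIoc s t → gramOp i (f r) = k r := by
    rw [ae_restrict_iff' measurableSet_Ioo] at hk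
    filter_upwards [hk] with r hr hm using hr (hsub hm)
  -- Both arguments of the bounded form are primitives in `V`, so the product rule applies although
  -- `f` itself has no derivative in `V`. Symmetry of `Q n` makes the two terms equal.
  have key : ∀ n, inner ℝ (k t) (Q n (k t)) - inner ℝ (k s) (Q n (k s))
      = ∫ r in s..t, 2 * inner ℝ (w r) (Q n (gramOp i (f r))) := by
    intro n
    have := (bilinear_primitive_sub ((innerBilin V).bilinearComp (.id ℝ V) (Q n))
      iw hkp iw hkp hs' ht').2
    simp only [ContinuousLinearMap.bilinearComp_apply, innerBilin_apply,
      ContinuousLinearMap.coe_id', id_eq] at this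
    rw [this]
    refine intervalIntegral.integral_congr_ae ?_
    filter_upwards [hk'] with r hr hm
    rw [hr hm, ← hsym n (k r), real_inner_comm (w r) (Q n (k r)), two_mul]
  have hlimk : ∀ r, gramOp i (f r) = k r →
      Tendsto (fun n => inner ℝ (k r) (Q n (k r))) atTop (𝓝 (‖i (f r)‖ ^ 2)) := by
    intro r hr
    rw [← hr]
    have := (tendsto_const_nhds (x := gramOp i (f r))).inner (𝕜 := ℝ) (hlim (f r))
    rwa [inner_gramOp, real_inner_self_eq_norm_sq] at this
  have L1 := (hlimk t hkt).sub (hlimk s hks)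
  simp only [key] at L1
  refine tendsto_nhds_unique L1 ?_
  have hμ : volume.restrict (uIoc s t) ≤ volume.restrict (Ioo 0 T) :=
    Measure.restrict_mono hsub le_rfl
  have hf' := hf.mono_measure hμ
  have hw' := hw.mono_measure hμ
  -- The contraction bound supplies the dominating function `2 ‖w‖ ‖f‖`.
  refine intervalIntegral.tendsto_integral_filter_of_dominated_convergence
    (fun r => 2 * (‖w r‖ * ‖f r‖)) ?_ ?_ ?_ ?_
  · refine Eventually.of_forall fun n => ?_
    exact (hw'.1.inner (((Q n).comp (gramOp i)).continuous.comp_aestronglyMeasurable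
      hf'.1)).const_mul 2
  · refine Eventually.of_forall fun n => Eventually.of_forall fun r _ => ?_
    rw [norm_mul, Real.norm_ofNat]
    gcongr
    exact (norm_inner_le_norm _ _).trans (by gcongr; exact hle n _)
  · rw [intervalIntegrable_iff]
    exact (hw'.norm.integrable_mul hf'.norm).const_mul 2
  · refine Eventually.of_forall fun r _ => ?_
    exact ((tendsto_const_nhds.inner (hlim (f r)))).const_mul 2

/-- The square equals `‖i f(t)‖² - ‖i f(s)‖² - 2 (i†i (f(t) - f(s)), f(s))`. The energy identity and
the primitive for `i†i f` turn this into `∫ 2 (w, f - f(s))` from `s` to `t`. The fixed vector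
`f(s)` is harmless when `‖f(s)‖²` is at most the mean of `‖f‖²` over the window, which is `hfs`. -/
lemma norm_sub_sq_le_of_mem (hT : 0 ≤ T) {i : V →L[ℝ] H} (hi : Function.Injective i)
    (hf : MemLp f 2 (volume.restrict (Ioo 0 T))) (hw : MemLp w 2 (volume.restrict (Ioo 0 T)))
    (hk : ∀ᵐ t ∂volume.restrict (Ioo 0 T), gramOp i (f t) = c + ∫ r in (0 : ℝ)..t, w r)
    {a b s t : ℝ} (ha : 0 ≤ a) (hab : a ≤ b) (hb : b ≤ T) (hs : s ∈ Ioo a b) (ht : t ∈ Ioo a b)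
    (hks : gramOp i (f s) = c + ∫ r in (0 : ℝ)..s, w r)
    (hkt : gramOp i (f t) = c + ∫ r in (0 : ℝ)..t, w r)
    (hfs : (b - a) * ‖f s‖ ^ 2 ≤ ∫ r in a..b, ‖f r‖ ^ 2) :
    ‖i (f t) - i (f s)‖ ^ 2 ≤ 2 * ∫ r in a..b, (‖f r‖ ^ 2 + ‖w r‖ ^ 2) := by
  have hss : s ∈ Ioo 0 T := ⟨ha.trans_lt hs.1, hs.2.trans_le hb⟩
  have htt : t ∈ Ioo 0 T := ⟨ha.trans_lt ht.1, ht.2.trans_le hb⟩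
  have hE := energy_identity_of_mem hT hi hf hw hk hss htt hks hkt
  have iw := intervalIntegrable_of_memLp hw hT
  have sub : ∀ {x y}, x ∈ Icc 0 T → y ∈ Icc 0 T → uIcc x y ⊆ uIcc 0 T := fun hx hy => by
    rw [uIcc_of_le hT]; exact ordConnected_Icc.uIcc_subset hx hy
  have h0m : (0 : ℝ) ∈ Icc 0 T := ⟨le_rfl, hT⟩
  have hsm := Ioo_subset_Icc_self hss
  have htm := Ioo_subset_Icc_self htt
  have ham : a ∈ Icc 0 T := ⟨ha, hab.trans hb⟩
  have hbm : b ∈ Icc 0 T := ⟨ha.trans hab, hb⟩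
  have hd : gramOp i (f t) - gramOp i (f s) = ∫ r in s..t, w r := by
    rw [hkt, hks, add_sub_add_left_eq_sub, intervalIntegral.integral_interval_sub_left
      (iw.mono_set (sub h0m htm)) (iw.mono_set (sub h0m hsm))]
  have iwf : IntervalIntegrable (fun r => inner ℝ (w r) (f r)) volume 0 T :=
    intervalIntegrable_of_integrable_Ioo hT (integrable_inner_of_memLp hw hf)
  have iff' : IntervalIntegrable (fun r => ‖f r‖ ^ 2) volume 0 T :=
    intervalIntegrable_of_integrable_Ioo hT hf.norm.integrable_sq
  have iww : IntervalIntegrable (fun r => ‖w r‖ ^ 2) volume 0 T :=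
    intervalIntegrable_of_integrable_Ioo hT hw.norm.integrable_sq
  have hst := sub hsm htm
  have habs := sub ham hbm
  have expand : ‖i (f t) - i (f s)‖ ^ 2
      = ∫ r in s..t, (2 * inner ℝ (w r) (f r) - 2 * inner ℝ (w r) (f s)) := by
    have iwst := iw.mono_set hst
    have iws : IntervalIntegrable (fun r => inner ℝ (w r) (f s)) volume s t :=
      ⟨iwst.1.inner_const (𝕜 := ℝ) _, iwst.2.inner_const (𝕜 := ℝ) _⟩
    have e : ∫ r in s..t, inner ℝ (w r) (f s) = inner ℝ (∫ r in s..t, w r) (f s) :=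
      ((innerBilin V).flip (f s)).intervalIntegral_comp_comm iwst
    rw [intervalIntegral.integral_sub ((iwf.mono_set hst).const_mul 2) (iws.const_mul 2), ← hE,
      intervalIntegral.integral_const_mul, e, ← hd, inner_sub_left, inner_gramOp, inner_gramOp, norm_sub_sq_real,
      real_inner_self_eq_norm_sq]
    ring
  have iM : IntervalIntegrable (fun r => ‖f r‖ ^ 2 + 2 * ‖w r‖ ^ 2 + ‖f s‖ ^ 2) volume a b :=
    ((iff'.add (iww.const_mul 2)).mono_set habs).add (by simp)
  rw [expand]
  calc ∫ r in s..t, (2 * inner ℝ (w r) (f r) - 2 * inner ℝ (w r) (f s))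
      ≤ ‖∫ r in s..t, (2 * inner ℝ (w r) (f r) - 2 * inner ℝ (w r) (f s))‖ := Real.le_norm_self _
    _ ≤ ∫ r in uIoc s t, ‖2 * inner ℝ (w r) (f r) - 2 * inner ℝ (w r) (f s)‖ :=
        intervalIntegral.norm_integral_le_integral_norm_uIoc
    _ ≤ ∫ r in uIoc s t, (‖f r‖ ^ 2 + 2 * ‖w r‖ ^ 2 + ‖f s‖ ^ 2) := by
        refine integral_mono_of_nonneg (Eventually.of_forall fun _ => norm_nonneg _) ?_
          (Eventually.of_forall fun r => ?_)
        · refine (intervalIntegrable_iff_integrableOn_Ioc_of_le hab).1 iM |>.mono_set ?_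
          rw [uIoc]
          exact Ioc_subset_Ioc (le_min hs.1.le ht.1.le) (max_le hs.2.le ht.2.le)
        · have h1 := norm_inner_le_norm (𝕜 := ℝ) (w r) (f r)
          have h2 := norm_inner_le_norm (𝕜 := ℝ) (w r) (f s)
          have h3 := norm_sub_le (2 * inner ℝ (w r) (f r)) (2 * inner ℝ (w r) (f s))
          rw [norm_mul, norm_mul, Real.norm_ofNat] at h3
          nlinarith [sq_nonneg (‖f r‖ - ‖w r‖), sq_nonneg (‖f s‖ - ‖w r‖)]
    _ ≤ ∫ r in Ioc a b, (‖f r‖ ^ 2 + 2 * ‖w r‖ ^ 2 + ‖f s‖ ^ 2) := by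
        refine setIntegral_mono_set ((intervalIntegrable_iff_integrableOn_Ioc_of_le hab).1 iM)
          (Eventually.of_forall fun _ => by positivity) (LE.le.eventuallyLE ?_)
        rw [uIoc]
        exact Ioc_subset_Ioc (le_min hs.1.le ht.1.le) (max_le hs.2.le ht.2.le)
    _ = ∫ r in a..b, (‖f r‖ ^ 2 + 2 * ‖w r‖ ^ 2 + ‖f s‖ ^ 2) :=
        (intervalIntegral.integral_of_le hab).symm
    _ ≤ 2 * ∫ r in a..b, (‖f r‖ ^ 2 + ‖w r‖ ^ 2) := by
        rw [intervalIntegral.integral_add ((iff'.add (iww.const_mul 2)).mono_set habs) (by simp),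
          intervalIntegral.integral_add (iff'.mono_set habs) ((iww.const_mul 2).mono_set habs),
          intervalIntegral.integral_add (iff'.mono_set habs) (iww.mono_set habs),
          intervalIntegral.integral_const_mul, intervalIntegral.integral_const, smul_eq_mul]
        linarith

/-- The embedding `Y ⊂ C([0, T]; H)`, together with the energy identity. -/
theorem exists_continuous_representative (hT : 0 < T) {i : V →L[ℝ] H}
    (hi : Function.Injective i)
    (hf : MemLp f 2 (volume.restrict (Ioo 0 T))) (hw : MemLp w 2 (volume.restrict (Ioo 0 T)))
    (hk : ∀ᵐ t ∂volume.restrict (Ioo 0 T), gramOp i (f t) = c + ∫ r in (0 : ℝ)..t, w r) :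
    ∃ h : ℝ → H, ContinuousOn h (Icc 0 T) ∧
      (∀ᵐ t ∂volume.restrict (Ioo 0 T), h t = i (f t)) ∧
      ‖h T‖ ^ 2 - ‖h 0‖ ^ 2 = 2 * ∫ r in Ioo 0 T, inner ℝ (w r) (f r) ∧
      (∀ t ∈ Icc 0 T, h t ∈ closure (range i)) ∧
      ∀ t ∈ Icc 0 T, ContinuousLinearMap.adjoint i (h t) = c + ∫ r in (0 : ℝ)..t, w r := by
  set k : ℝ → V := fun t => c + ∫ r in (0 : ℝ)..t, w r with hkdef
  -- `D` has full measure in `(0, T)`, hence is dense in `[0, T]`; the representative is the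
  -- continuous extension of `i ∘ f` from `D`.
  set D : Set ℝ := Ioo 0 T ∩ {t | t ∈ Ioo 0 T → gramOp i (f t) = k t} with hD
  have hDk : ∀ t ∈ D, gramOp i (f t) = k t := fun t ht => ht.2 ht.1
  have hDsub : D ⊆ Icc 0 T := fun t ht => Ioo_subset_Icc_self ht.1
  have hDae : ∀ᵐ t ∂volume.restrict (Ioo 0 T), t ∈ D := by
    filter_upwards [hk, ae_restrict_mem measurableSet_Ioo] with t h1 h2 using ⟨h2, fun _ => h1⟩
  have hDcl : Icc 0 T ⊆ closure D := by
    have hdense : Dense {t | t ∈ Ioo 0 T → gramOp i (f t) = k t} :=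
      Measure.dense_of_ae (μ := volume) ((ae_restrict_iff' measurableSet_Ioo).1 hk)
    rw [← closure_Ioo hT.ne]
    exact closure_minimal (hdense.open_subset_closure_inter isOpen_Ioo) isClosed_closure
  have iw := intervalIntegrable_of_memLp hw hT.le
  have iE : IntervalIntegrable (fun r => ‖f r‖ ^ 2 + ‖w r‖ ^ 2) volume 0 T :=
    intervalIntegrable_of_integrable_Ioo hT.le
      (hf.norm.integrable_sq.add hw.norm.integrable_sq)
  have iff' : Integrable (fun r => ‖f r‖ ^ 2) (volume.restrict (Ioo 0 T)) :=
    hf.norm.integrable_sq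
  set Φ : ℝ → ℝ := fun t => ∫ r in (0 : ℝ)..t, (‖f r‖ ^ 2 + ‖w r‖ ^ 2) with hΦ
  have Φc : ContinuousOn Φ (Icc 0 T) := by
    rw [← uIcc_of_le hT.le]
    exact continuousOn_of_eq_primitive iE fun t _ => by simp [hΦ]
  have hlim : ∀ t₀ ∈ Icc 0 T, ∃ y, Tendsto (fun t => i (f t)) (𝓝[D] t₀) (𝓝 y) := by
    intro t₀ ht₀
    have : (𝓝[D] t₀).NeBot := mem_closure_iff_nhdsWithin_neBot.1 (hDcl ht₀)
    rw [← cauchy_map_iff_exists_tendsto, Metric.cauchy_iff]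
    refine ⟨inferInstance, fun ε hε => ?_⟩
    -- Two endpoints within `ε² / 64` bound the energy over the window by `ε² / 32`. The estimate
    -- doubles this to `(ε / 4)²`, so all values lie within `ε / 4` of `i (f s)` and within `ε / 2`
    -- of each other.
    obtain ⟨δ, hδ, hcont⟩ := Metric.continuousWithinAt_iff.1 (Φc t₀ ht₀) (ε ^ 2 / 64)
      (by positivity)
    set a := max 0 (t₀ - δ / 2) with ha
    set b := min T (t₀ + δ / 2) with hb
    have ha0 : 0 ≤ a := le_max_left _ _
    have hbT : b ≤ T := min_le_left _ _
    have hat : a ≤ t₀ := max_le ht₀.1 (by linarith)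
    have htb : t₀ ≤ b := le_min ht₀.2 (by linarith)
    have hab : a < b := by
      rcases ht₀.1.eq_or_lt with h | h
      · refine lt_of_le_of_lt (max_le (le_refl 0) (by linarith)) (lt_min hT (by linarith))
      · exact lt_of_lt_of_le (max_lt h (by linarith)) htb
    have ham : a ∈ Icc 0 T := ⟨ha0, hab.le.trans hbT⟩
    have hbm : b ∈ Icc 0 T := ⟨ha0.trans hab.le, hbT⟩
    have hda := hcont ham (by
      rw [Real.dist_eq, abs_lt]; constructor <;> linarith [le_max_right 0 (t₀ - δ / 2)])
    have hdb := hcont hbm (by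
      rw [Real.dist_eq, abs_lt]; constructor <;> linarith [min_le_right T (t₀ + δ / 2)])
    have hint : ∫ r in a..b, (‖f r‖ ^ 2 + ‖w r‖ ^ 2) < ε ^ 2 / 32 := by
      have : Φ b - Φ a = ∫ r in a..b, (‖f r‖ ^ 2 + ‖w r‖ ^ 2) :=
        intervalIntegral.integral_interval_sub_left
          (iE.mono_set (by rw [uIcc_of_le hT.le, uIcc_of_le hbm.1]; exact Icc_subset_Icc_right hbT))
          (iE.mono_set (by
            rw [uIcc_of_le hT.le, uIcc_of_le ha0]; exact Icc_subset_Icc_right ham.2))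
      rw [← this]
      rw [Real.dist_eq, abs_lt] at hda hdb
      linarith [hda.1, hdb.2]
    have hJ : Ioo a b ⊆ Ioo 0 T := Ioo_subset_Ioo ha0 hbT
    -- A time in `D` at which `‖f‖²` does not exceed its average over the window.
    obtain ⟨s, hsN, hs⟩ : ∃ s, s ∉ (D ∩ Ioo a b)ᶜ ∧
        ‖f s‖ ^ 2 ≤ ⨍ r, ‖f r‖ ^ 2 ∂volume.restrict (Ioo a b) := by
      refine exists_notMem_null_le_average ?_ (iff'.mono_measure (Measure.restrict_mono hJ le_rfl))
        ?_
      · rw [Ne, Measure.restrict_eq_zero, Real.volume_Ioo, ENNReal.ofReal_eq_zero]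
        linarith
      · have h1 : ∀ᵐ r ∂volume.restrict (Ioo a b), r ∈ D ∩ Ioo a b := by
          filter_upwards [ae_restrict_of_ae_restrict_of_subset hJ hDae,
            ae_restrict_mem measurableSet_Ioo] with r h1 h2 using ⟨h1, h2⟩
        exact h1
    rw [notMem_compl_iff] at hsN
    have hfs : (b - a) * ‖f s‖ ^ 2 ≤ ∫ r in a..b, ‖f r‖ ^ 2 := by
      rw [average_eq, smul_eq_mul, measureReal_restrict_apply_univ, Real.volume_real_Ioo_of_le hab.le,
        ← integral_Ioc_eq_integral_Ioo, ← intervalIntegral.integral_of_le hab.le,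
        inv_mul_eq_div, le_div_iff₀ (by linarith)] at hs
      linarith
    have hclose : ∀ t ∈ D ∩ Ioo a b, ‖i (f t) - i (f s)‖ ≤ ε / 4 := by
      intro t ht
      have := norm_sub_sq_le_of_mem hT.le hi hf hw hk ha0 hab.le hbT hsN.2 ht.2
        (hDk s hsN.1) (hDk t ht.1) hfs
      refine abs_le_of_sq_le_sq' ?_ (by positivity) |>.2
      nlinarith
    refine ⟨(fun t => i (f t)) '' (D ∩ Ioo a b), image_mem_map ?_, ?_⟩
    · have hball : Ioo (t₀ - δ / 2) (t₀ + δ / 2) ∈ 𝓝 t₀ := Ioo_mem_nhds (by linarith) (by linarith)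
      filter_upwards [self_mem_nhdsWithin, mem_nhdsWithin_of_mem_nhds hball] with t h1 h2
      exact ⟨h1, max_lt h1.1.1 h2.1, lt_min h1.1.2 h2.2⟩
    · rintro _ ⟨x, hx, rfl⟩ _ ⟨y, hy, rfl⟩
      have e1 := hclose x hx
      have e2 := hclose y hy
      rw [← dist_eq_norm] at e1 e2
      have := dist_triangle_right (i (f x)) (i (f y)) (i (f s))
      simp only
      linarith
  set h : ℝ → H := extendFrom D fun t => i (f t) with hh
  have hc : ContinuousOn h (Icc 0 T) := continuousOn_extendFrom hDcl hlim
  have hDh : ∀ t ∈ D, h t = i (f t) := by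
    intro t ht
    obtain ⟨y, hy⟩ := hlim t (hDsub ht)
    have e : i (f t) = y := tendsto_nhds_unique
      (tendsto_pure_nhds (fun t => i (f t)) t) (hy.mono_left (pure_le_nhdsWithin ht))
    exact (extendFrom_eq (hDcl (hDsub ht)) hy).trans e.symm
  have hkc : ContinuousOn k (Icc 0 T) := by
    rw [← uIcc_of_le hT.le]
    exact continuousOn_of_eq_primitive iw fun t _ => by simp [hkdef]
  refine ⟨h, hc, ?_, ?_, ?_, ?_⟩
  · filter_upwards [hDae] with t ht using hDh t ht
  · obtain ⟨s, hs⟩ : D.Nonempty :=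
      closure_nonempty_iff.1 ⟨0, hDcl ⟨le_rfl, hT.le⟩⟩
    have ip : IntervalIntegrable (fun r => 2 * inner ℝ (w r) (f r)) volume 0 T :=
      intervalIntegrable_of_integrable_Ioo hT.le ((integrable_inner_of_memLp hw hf).const_mul 2)
    set Ψ : ℝ → ℝ := fun t => ∫ r in (0 : ℝ)..t, 2 * inner ℝ (w r) (f r) with hΨ
    have Ψc : ContinuousOn Ψ (Icc 0 T) := by
      rw [← uIcc_of_le hT.le]
      exact continuousOn_of_eq_primitive ip fun t _ => by simp [hΨ]
    have sub : ∀ {x}, x ∈ Icc 0 T → uIcc 0 x ⊆ uIcc 0 T := fun hx => by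
      rw [uIcc_of_le hT.le]; exact ordConnected_Icc.uIcc_subset ⟨le_rfl, hT.le⟩ hx
    -- The energy identity holds on `D`; both sides are continuous, so it extends to the endpoints
    -- `0` and `T`.
    have heq : EqOn (fun t => ‖h t‖ ^ 2) (fun t => ‖h s‖ ^ 2 + (Ψ t - Ψ s)) D := by
      intro t ht
      have e := energy_identity_of_mem hT.le hi hf hw hk hs.1 ht.1 (hDk s hs) (hDk t ht)
      rw [← intervalIntegral.integral_interval_sub_left (ip.mono_set (sub (hDsub ht)))
        (ip.mono_set (sub (hDsub hs)))] at e
      simp only [hDh t ht, hDh s hs]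
      linarith
    have heq' := heq.of_subset_closure (hc.norm.pow 2)
      (continuousOn_const.add (Ψc.sub continuousOn_const)) hDsub hDcl
    have e1 := heq' (show T ∈ Icc 0 T from ⟨hT.le, le_rfl⟩)
    have e2 := heq' (show (0 : ℝ) ∈ Icc 0 T from ⟨le_rfl, hT.le⟩)
    simp only at e1 e2
    have h0 : Ψ 0 = 0 := by simp [hΨ]
    have hTt : Ψ T = 2 * ∫ r in Ioo 0 T, inner ℝ (w r) (f r) := by
      rw [setIntegral_Ioo_eq_intervalIntegral hT.le, hΨ]
      exact intervalIntegral.integral_const_mul _ _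
    linarith
  · intro t ht
    have hct := (hc t ht).mono hDsub
    refine closure_mono ?_ (hct.mem_closure_image (hDcl ht))
    rintro _ ⟨r, hr, rfl⟩
    exact ⟨f r, (hDh r hr).symm⟩
  · have heq : EqOn (fun t => ContinuousLinearMap.adjoint i (h t)) k D := fun t ht => by
      simp only [hDh t ht]
      exact hDk t ht
    exact heq.of_subset_closure
      ((ContinuousLinearMap.adjoint i).continuous.comp_continuousOn hc) hkc hDsub hDcl

end Energy

/-! ### The Hilbert space `H¹₀(Ω)` -/

lemma norm_sq_eq_integral {α E : Type*} [NormedAddCommGroup E] [InnerProductSpace ℝ E]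
    {_ : MeasurableSpace α} {μ : Measure α} (f : Lp E 2 μ) : ‖f‖ ^ 2 = ∫ x, ‖f x‖ ^ 2 ∂μ := by
  rw [← real_inner_self_eq_norm_sq, L2.inner_def]
  simp only [real_inner_self_eq_norm_sq]

section Spatial

open InnerProductSpace

variable {d : ℕ} {Ω : Set (EuclideanSpace ℝ (Fin d))}

lemma IsTestFun.mul_left {E : Type*} [NormedAddCommGroup E] [NormedSpace ℝ E] {S : Set E}
    {φ ψ : E → ℝ} (hφ : IsTestFun S φ) (hψ : ContDiff ℝ ∞ ψ) : IsTestFun S (ψ * φ) :=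
  ⟨hψ.mul hφ.contDiff, hφ.hasCompactSupport.mul_left,
    (tsupport_mul_subset_right).trans hφ.tsupport_subset⟩

/-- Both integrands vanish outside `Ω`, so the integrals are over the whole space and no boundary
term or regularity of `∂Ω` enters; `ψ` need not have compact support. -/
lemma IsTestFun.integral_mul_fderiv {φ ψ : EuclideanSpace ℝ (Fin d) → ℝ} (hφ : IsTestFun Ω φ)
    (hψ : ContDiff ℝ ∞ ψ) (e : EuclideanSpace ℝ (Fin d)) :
    ∫ x in Ω, φ x * fderiv ℝ ψ x e = - ∫ x in Ω, fderiv ℝ φ x e * ψ x := by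
  have cφ := hφ.contDiff.continuous
  have cφ' : Continuous fun x => fderiv ℝ φ x e :=
    (hφ.contDiff.continuous_fderiv (by simp)).clm_apply continuous_const
  have cψ' : Continuous fun x => fderiv ℝ ψ x e :=
    (hψ.continuous_fderiv (by simp)).clm_apply continuous_const
  have sφ' : HasCompactSupport fun x => fderiv ℝ φ x e :=
    hφ.hasCompactSupport.fderiv_apply (𝕜 := ℝ) e
  have z : ∀ x, x ∉ Ω → fderiv ℝ φ x e = 0 := fun x hx => by
    have : x ∉ tsupport (fderiv ℝ φ) := fun h =>
      hx (hφ.tsupport_subset (tsupport_fderiv_subset ℝ h))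
    rw [image_eq_zero_of_notMem_tsupport this]; rfl
  rw [setIntegral_eq_integral_of_forall_compl_eq_zero fun x hx => by
      rw [hφ.eq_zero hx, zero_mul],
    setIntegral_eq_integral_of_forall_compl_eq_zero fun x hx => by rw [z x hx, zero_mul]]
  refine integral_mul_fderiv_eq_neg_fderiv_mul_of_integrable ?_ ?_ ?_
    (fun x _ => (hφ.contDiff.differentiable (by simp)).differentiableAt)
    (fun x _ => (hψ.differentiable (by simp)).differentiableAt)
  · exact (cφ'.mul hψ.continuous).integrable_of_hasCompactSupport sφ'.mul_right
  · exact (cφ.mul cψ').integrable_of_hasCompactSupport hφ.hasCompactSupport.mul_right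
  · exact (cφ.mul hψ.continuous).integrable_of_hasCompactSupport hφ.hasCompactSupport.mul_right

/-- The Poincaré inequality for a function which is a.e. equal to a test function. -/
lemma HasWeakGrad.integral_sq_le (i : Fin d) {R : ℝ} (hR : ∀ x ∈ Ω, |x i| ≤ R)
    (hΩ : MeasurableSet Ω) {p : WithLp 2 (L2 Ω × L2Vec Ω)} (hp : HasWeakGrad Ω p.fst p.snd)
    {φ : EuclideanSpace ℝ (Fin d) → ℝ} (hφ : IsTestFun Ω φ)
    (h : p.fst =ᵐ[volume.restrict Ω] φ) :
    ‖p.fst‖ ^ 2 ≤ 4 * R ^ 2 * ‖p.snd‖ ^ 2 := by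
  set e : EuclideanSpace ℝ (Fin d) := EuclideanSpace.single i 1
  set c : EuclideanSpace ℝ (Fin d) → ℝ := fun x => x i with hc
  have hcs : ContDiff ℝ ∞ c := (EuclideanSpace.proj (𝕜 := ℝ) i).contDiff
  have hce : ∀ x, fderiv ℝ c x e = 1 := fun x => by
    have : fderiv ℝ c x = EuclideanSpace.proj (𝕜 := ℝ) i :=
      (EuclideanSpace.proj (𝕜 := ℝ) i).fderiv
    rw [this]; simp [e]
  -- The test function `xᵢ φ` satisfies `∂ᵢ(xᵢ φ) = φ + xᵢ ∂ᵢφ`. Classical integration by parts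
  -- gives `∫ φ ∂ᵢ(xᵢ φ) = ½ ∫ φ²`, the weak gradient `g` gives `-∫ gᵢ xᵢ φ`, and the latter is at
  -- most `¼ ∫ φ² + R² ∫ |g|²`.
  have hψ : IsTestFun Ω (c * φ) := hφ.mul_left hcs
  have hder : ∀ x, fderiv ℝ (c * φ) x e = φ x + c x * fderiv ℝ φ x e := fun x => by
    rw [fderiv_mul (hcs.differentiable (by simp)).differentiableAt
      (hφ.contDiff.differentiable (by simp)).differentiableAt]
    simp [hce, add_comm]
  have hφ2 : Integrable (fun x => φ x ^ 2) (volume.restrict Ω) := hφ.memLp.integrable_sq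
  have iB : Integrable (fun x => fderiv ℝ φ x e * (c * φ) x) (volume.restrict Ω) :=
    (hφ.memLp_fderiv e).integrable_mul hψ.memLp
  have h1 := hφ.integral_mul_fderiv hψ.contDiff e
  have h2 : ∫ x in Ω, φ x * fderiv ℝ (c * φ) x e
      = (∫ x in Ω, φ x ^ 2) + ∫ x in Ω, fderiv ℝ φ x e * (c * φ) x := by
    rw [← integral_add hφ2 iB]
    congr 1 with x
    rw [hder, Pi.mul_apply]; ring
  have h3 := hp _ hψ i
  have h4 : ∫ x in Ω, p.fst x * fderiv ℝ (c * φ) x e = ∫ x in Ω, φ x * fderiv ℝ (c * φ) x e := by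
    refine integral_congr_ae ?_
    filter_upwards [h] with x hx
    rw [hx]
  have ig : Integrable (fun x => ‖p.snd x‖ ^ 2) (volume.restrict Ω) :=
    (Lp.memLp p.snd).norm.integrable_sq
  have h5 : - ∫ x in Ω, p.snd x i * (c * φ) x
      ≤ ∫ x in Ω, (1 / 4 * φ x ^ 2 + R ^ 2 * ‖p.snd x‖ ^ 2) := by
    rw [← integral_neg]
    refine integral_mono_ae (integrable_coord_mul_test _ i hψ.memLp).neg
      ((hφ2.const_mul _).add (ig.const_mul _)) ?_
    filter_upwards [ae_restrict_mem hΩ] with x hx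
    have e1 : |p.snd x i| ≤ ‖p.snd x‖ := PiLp.norm_apply_le (p.snd x) i
    have e2 := hR x hx
    have e3 : |p.snd x i| * |c x| ≤ ‖p.snd x‖ * R := by gcongr
    have e4 : -(p.snd x i * (c * φ) x) ≤ |p.snd x i| * |c x| * |φ x| := by
      rw [← abs_mul, ← abs_mul, Pi.mul_apply, ← mul_assoc]; exact neg_le_abs _
    have e5 : |p.snd x i| * |c x| * |φ x| ≤ ‖p.snd x‖ * R * |φ x| := by gcongr
    have e6 := sq_abs (φ x)
    nlinarith [sq_nonneg (‖p.snd x‖ * R - 1 / 2 * |φ x|)]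
  rw [integral_add (hφ2.const_mul _) (ig.const_mul _), integral_const_mul,
    integral_const_mul, ← norm_sq_eq_integral] at h5
  have h6 : ‖p.fst‖ ^ 2 = ∫ x in Ω, φ x ^ 2 := by
    rw [norm_sq_eq_integral]
    refine integral_congr_ae ?_
    filter_upwards [h] with x hx
    rw [hx, Real.norm_eq_abs, sq_abs]
  rw [h6]
  linarith

lemma norm_sq_H10 (u : H10 Ω) : ‖u‖ ^ 2 = ‖toL2 Ω u‖ ^ 2 + ‖grad Ω u‖ ^ 2 :=
  WithLp.prod_norm_sq_eq_of_L2 (H10.toH1 Ω u : WithLp 2 (L2 Ω × L2Vec Ω))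

/-- The Poincaré inequality. -/
theorem exists_poincare (hd : 1 ≤ d) (hΩo : IsOpen Ω) (hΩb : Bornology.IsBounded Ω) :
    ∃ C, 0 < C ∧ ∀ u : H10 Ω, ‖u‖ ^ 2 ≤ C * ‖grad Ω u‖ ^ 2 := by
  obtain ⟨R, hR⟩ := hΩb.exists_norm_le
  refine ⟨4 * R ^ 2 + 1, by positivity, fun u => ?_⟩
  suffices H : ‖toL2 Ω u‖ ^ 2 ≤ 4 * R ^ 2 * ‖grad Ω u‖ ^ 2 by
    rw [norm_sq_H10]; linarith
  set s : Set (H1 Ω) := {p | ‖(p : WithLp 2 (L2 Ω × L2Vec Ω)).fst‖ ^ 2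
    ≤ 4 * R ^ 2 * ‖(p : WithLp 2 (L2 Ω × L2Vec Ω)).snd‖ ^ 2} with hs
  have hcl : IsClosed s := by
    have c1 : Continuous fun p : H1 Ω => (p : WithLp 2 (L2 Ω × L2Vec Ω)).fst :=
      ((WithLp.fstL 2 ℝ (L2 Ω) (L2Vec Ω)).comp (H1 Ω).subtypeL).continuous
    have c2 : Continuous fun p : H1 Ω => (p : WithLp 2 (L2 Ω × L2Vec Ω)).snd :=
      ((WithLp.sndL 2 ℝ (L2 Ω) (L2Vec Ω)).comp (H1 Ω).subtypeL).continuous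
    exact isClosed_le (c1.norm.pow 2) ((c2.norm.pow 2).const_mul _)
  have hsub : (testSubmodule Ω : Set (H1 Ω)) ⊆ s := by
    rintro p ⟨φ, hφ, h⟩
    exact HasWeakGrad.integral_sq_le ⟨0, hd⟩
      (fun x hx => (PiLp.norm_apply_le x _).trans (hR x hx)) hΩo.measurableSet p.2 hφ h
  have : H10.toH1 Ω u ∈ closure (testSubmodule Ω : Set (H1 Ω)) := u.2
  exact closure_minimal hsub hcl this

/-- Each instance of the weak gradient condition equates two continuous functionals of the pair,
namely `L²` inner products with `∂ᵢφ` and `φ`. Completeness of `H¹₀(Ω)` follows. -/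
lemma isClosed_H1 : IsClosed (H1 Ω : Set (WithLp 2 (L2 Ω × L2Vec Ω))) := by
  have hset : (H1 Ω : Set (WithLp 2 (L2 Ω × L2Vec Ω))) =
      ⋂ φ : {φ : EuclideanSpace ℝ (Fin d) → ℝ // IsTestFun Ω φ}, ⋂ i : Fin d,
        {p | inner ℝ ((φ.2.memLp_fderiv (μ := volume.restrict Ω)
            (EuclideanSpace.single i 1)).toLp _ : L2 Ω) p.fst
          = - inner ℝ ((φ.2.memLp (μ := volume.restrict Ω)).toLp _ : L2 Ω)
            ((EuclideanSpace.proj (𝕜 := ℝ) i).compLp p.snd)} := by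
    ext p
    simp only [mem_iInter, Subtype.forall, mem_ofPred_eq, SetLike.mem_coe]
    refine forall_congr' fun φ => forall_congr' fun hφ => forall_congr' fun i => ?_
    rw [L2.inner_def, L2.inner_def]
    have e1 : ∫ x in Ω, inner ℝ ((hφ.memLp_fderiv (μ := volume.restrict Ω)
            (EuclideanSpace.single i 1)).toLp _ x) (p.fst x)
        = ∫ x in Ω, p.fst x * fderiv ℝ φ x (EuclideanSpace.single i 1) := by
      refine integral_congr_ae ?_
      filter_upwards [(hφ.memLp_fderiv (μ := volume.restrict Ω)
            (EuclideanSpace.single i 1)).coeFn_toLp] with x hx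
      rw [hx]; simp
    have e2 : ∫ x in Ω, inner ℝ ((hφ.memLp (μ := volume.restrict Ω)).toLp _ x)
          ((EuclideanSpace.proj (𝕜 := ℝ) i).compLp p.snd x)
        = ∫ x in Ω, p.snd x i * φ x := by
      refine integral_congr_ae ?_
      filter_upwards [(hφ.memLp (μ := volume.restrict Ω)).coeFn_toLp,
        (EuclideanSpace.proj (𝕜 := ℝ) i).coeFn_compLp p.snd] with x hx hx'
      rw [hx, hx']; simp
    rw [e1, e2]
  rw [hset]
  refine isClosed_iInter fun φ => isClosed_iInter fun i => isClosed_eq ?_ ?_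
  · exact continuous_const.inner (WithLp.fstL 2 ℝ (L2 Ω) (L2Vec Ω)).continuous
  · exact (continuous_const.inner (((EuclideanSpace.proj (𝕜 := ℝ) i).compLpL 2
      (volume.restrict Ω)).continuous.comp (WithLp.sndL 2 ℝ (L2 Ω) (L2Vec Ω)).continuous)).neg

instance : CompleteSpace (H1 Ω) := isClosed_H1.completeSpace_coe

instance : CompleteSpace (H10 Ω) :=
  (testSubmodule Ω).isClosed_topologicalClosure.completeSpace_coe

/-- Elements carry their gradient as separate data, so the point is that the weak gradient of the
zero function vanishes, by the fundamental lemma of the calculus of variations. -/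
lemma toL2_injective (hΩo : IsOpen Ω) (hΩb : Bornology.IsBounded Ω) :
    Function.Injective (toL2 Ω) := by
  rw [injective_iff_map_eq_zero]
  intro u hu
  have hfin : IsFiniteMeasure (volume.restrict Ω) :=
    isFiniteMeasure_restrict.2 hΩb.measure_lt_top.ne
  have hw : HasWeakGrad Ω (toL2 Ω u) (grad Ω u) := (H10.toH1 Ω u).2
  have h0 : (toL2 Ω u : EuclideanSpace ℝ (Fin d) → ℝ) =ᵐ[volume.restrict Ω] 0 := by
    rw [hu]; exact Lp.coeFn_zero _ _ _
  have hg : ∀ i : Fin d, ∀ᵐ x, x ∈ Ω → grad Ω u x i = 0 := by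
    intro i
    have hm : MemLp (fun x => grad Ω u x i) 2 (volume.restrict Ω) :=
      (EuclideanSpace.proj (𝕜 := ℝ) i).comp_memLp' (Lp.memLp (grad Ω u))
    refine hΩo.ae_eq_zero_of_integral_contDiff_smul_eq_zero
      (IntegrableOn.locallyIntegrableOn (hm.integrable (by norm_num))) fun φ h1 h2 h3 => ?_
    have hφ : IsTestFun Ω φ := ⟨h1, h2, h3⟩
    have e := hw φ hφ i
    rw [integral_eq_zero_of_ae] at e
    · rw [← setIntegral_eq_integral_of_forall_compl_eq_zero (s := Ω) fun x hx => by
        rw [hφ.eq_zero hx, zero_smul]]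
      simp only [smul_eq_mul, mul_comm (φ _)]
      linarith
    · filter_upwards [h0] with x hx
      rw [hx]; simp
  have hg0 : grad Ω u = 0 := by
    rw [Lp.eq_zero_iff_ae_eq_zero, Filter.EventuallyEq, ae_restrict_iff' hΩo.measurableSet]
    filter_upwards [ae_all_iff.2 hg] with x hx hm
    ext i
    simpa using hx i hm
  have := norm_sq_H10 u
  rw [hu, hg0] at this
  simpa using this

/-- A test function, as an element of `H¹₀(Ω)`. -/
lemma IsTestFun.exists_H10 {φ : EuclideanSpace ℝ (Fin d) → ℝ} (hφ : IsTestFun Ω φ) :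
    ∃ u : H10 Ω, toL2 Ω u =ᵐ[volume.restrict Ω] φ := by
  set g : EuclideanSpace ℝ (Fin d) → EuclideanSpace ℝ (Fin d) := fun x =>
    ∑ i, fderiv ℝ φ x (EuclideanSpace.single i 1) • EuclideanSpace.single i (1 : ℝ) with hg
  have hgm : MemLp g 2 (volume.restrict Ω) := memLp_finsetSum _ fun i _ =>
    (ContinuousLinearMap.toSpanSingleton ℝ
      (EuclideanSpace.single i (1 : ℝ))).comp_memLp' (hφ.memLp_fderiv _)
  have hgi : ∀ x i, g x i = fderiv ℝ φ x (EuclideanSpace.single i 1) := fun x i => by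
    simp [hg, Finset.sum_apply, Pi.single_apply]
  set p : WithLp 2 (L2 Ω × L2Vec Ω) := WithLp.toLp 2 (hφ.memLp.toLp φ, hgm.toLp g)
  have hp : p ∈ H1 Ω := by
    intro ψ hψ i
    have e1 : ∫ x in Ω, p.fst x * fderiv ℝ ψ x (EuclideanSpace.single i 1)
        = ∫ x in Ω, φ x * fderiv ℝ ψ x (EuclideanSpace.single i 1) := by
      refine integral_congr_ae ?_
      filter_upwards [(hφ.memLp (μ := volume.restrict Ω)).coeFn_toLp] with x hx
      exact congrArg (· * _) hx
    have e2 : ∫ x in Ω, p.snd x i * ψ x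
        = ∫ x in Ω, fderiv ℝ φ x (EuclideanSpace.single i 1) * ψ x := by
      refine integral_congr_ae ?_
      filter_upwards [hgm.coeFn_toLp] with x hx
      rw [← hgi]
      exact congrArg (fun y : EuclideanSpace ℝ (Fin d) => y i * ψ x) hx
    rw [e1, e2]
    exact hφ.integral_mul_fderiv hψ.contDiff _
  have hmem : (⟨p, hp⟩ : H1 Ω) ∈ testSubmodule Ω := ⟨φ, hφ, hφ.memLp.coeFn_toLp⟩
  exact ⟨⟨⟨p, hp⟩, (testSubmodule Ω).le_topologicalClosure hmem⟩, hφ.memLp.coeFn_toLp⟩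

lemma exists_H10_ne_zero (hΩo : IsOpen Ω) (hΩn : Ω.Nonempty) : ∃ u : H10 Ω, u ≠ 0 := by
  obtain ⟨x, hx⟩ := hΩn
  obtain ⟨f, hf, hc, hs, hr, hf1⟩ := exists_contDiff_tsupport_subset (n := (⊤ : ℕ∞)) (hΩo.mem_nhds hx)
  obtain ⟨u, hu⟩ := IsTestFun.exists_H10 (Ω := Ω) (φ := f) ⟨hs, hc, hf⟩
  refine ⟨u, fun h0 => ?_⟩
  have h1 : (toL2 Ω u : EuclideanSpace ℝ (Fin d) → ℝ) =ᵐ[volume.restrict Ω] 0 := by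
    rw [h0, map_zero]; exact Lp.coeFn_zero _ _ _
  have h2 : f =ᵐ[volume.restrict Ω] 0 := hu.symm.trans h1
  have hopen : IsOpen {y | y ∈ Ω ∧ f y ≠ 0} :=
    hΩo.inter (isOpen_ne_fun hs.continuous continuous_const)
  have hpos := hopen.measure_pos volume ⟨x, hx, by rw [hf1]; exact one_ne_zero⟩
  rw [Filter.EventuallyEq, ae_restrict_iff' hΩo.measurableSet, ae_iff] at h2
  refine hpos.ne' ?_
  convert! h2 using 3
  simp

/-! ### The Riesz isomorphism for the Dirichlet form -/

/-- The Riesz representative of a functional. -/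
noncomputable def riesz (V : Type*) [NormedAddCommGroup V] [InnerProductSpace ℝ V]
    [CompleteSpace V] : (V →L[ℝ] ℝ) →L[ℝ] V :=
  LinearMap.mkContinuous
    { toFun := fun Φ => (InnerProductSpace.toDual ℝ V).symm Φ
      map_add' := fun _ _ => map_add _ _ _
      map_smul' := fun c Φ => by simp } 1 fun Φ => by simp

lemma inner_riesz {V : Type*} [NormedAddCommGroup V] [InnerProductSpace ℝ V]
    [CompleteSpace V] (Φ : V →L[ℝ] ℝ) (v : V) : inner ℝ (riesz V Φ) v = Φ v :=
  InnerProductSpace.toDual_symm_apply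

/-- Under the Riesz map a function in `H¹₀(Ω)`, regarded as an element of `H⁻¹(Ω)`, becomes its
image under `gramOp (toL2 Ω)`. -/
lemma riesz_embHm1 (w : L2 Ω) :
    riesz (H10 Ω) (embHm1 Ω w) = ContinuousLinearMap.adjoint (toL2 Ω) w := by
  refine ext_inner_right ℝ fun v => ?_
  rw [inner_riesz, ContinuousLinearMap.adjoint_inner_left]
  rfl

/-- The inverse Dirichlet Laplacian `H⁻¹(Ω) → H¹₀(Ω)`. -/
theorem exists_dirichlet_inverse (hd : 1 ≤ d) (hΩo : IsOpen Ω) (hΩb : Bornology.IsBounded Ω) :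
    ∃ J : Hm1 Ω →L[ℝ] H10 Ω,
      ∀ Φ v, inner ℝ (grad Ω (J Φ)) (grad Ω v) = Φ v := by
  obtain ⟨C, hC, hP⟩ := exists_poincare hd hΩo hΩb
  -- Coercivity of the Dirichlet form in the full `H¹` norm is the Poincaré inequality.
  have hco : IsCoercive ((innerBilin (L2Vec Ω)).bilinearComp (grad Ω) (grad Ω)) := by
    refine ⟨C⁻¹, inv_pos.2 hC, fun u => ?_⟩
    simp only [ContinuousLinearMap.bilinearComp_apply, innerBilin_apply,
      real_inner_self_eq_norm_sq]
    rw [mul_assoc, ← sq, inv_mul_le_iff₀ hC]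
    exact hP u
  refine ⟨(hco.continuousLinearEquivOfBilin.symm : H10 Ω →L[ℝ] H10 Ω).comp (riesz (H10 Ω)),
    fun Φ v => ?_⟩
  have := hco.continuousLinearEquivOfBilin_apply
    (hco.continuousLinearEquivOfBilin.symm (riesz (H10 Ω) Φ)) v
  rw [ContinuousLinearEquiv.apply_symm_apply, inner_riesz] at this
  exact this.symm

/-- Cauchy–Schwarz for the Dirichlet form bounds every quotient, and `v = JΦ` attains the bound. -/
lemma normHm1_eq {J : Hm1 Ω →L[ℝ] H10 Ω}
    (hJ : ∀ Φ v, inner ℝ (grad Ω (J Φ)) (grad Ω v) = Φ v) (Φ : Hm1 Ω) :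
    normHm1 Ω Φ = ‖grad Ω (J Φ)‖ := by
  set g := ‖grad Ω (J Φ)‖
  have hub : ∀ r ∈ {r : ℝ | ∃ v : H10 Ω, v ≠ 0 ∧ r = Φ v / ‖grad Ω v‖}, r ≤ g := by
    rintro r ⟨v, -, rfl⟩
    refine div_le_of_le_mul₀ (norm_nonneg _) (norm_nonneg _) ?_
    rw [← hJ]
    exact real_inner_le_norm _ _
  have hself : Φ (J Φ) = g ^ 2 := by rw [← hJ, real_inner_self_eq_norm_sq]
  rcases (norm_nonneg (grad Ω (J Φ))).eq_or_lt with h0 | h0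
  -- Here `Φ = 0` and all quotients vanish; if there are none, `sSup ∅ = 0` agrees.
  · have hΦ : ∀ v, Φ v = 0 := fun v => by
      rw [← hJ, norm_eq_zero.1 h0.symm, inner_zero_left]
    refine le_antisymm (Real.sSup_le hub (norm_nonneg _)) ?_
    rw [show g = 0 from h0.symm]
    refine Real.sSup_nonneg ?_
    rintro r ⟨v, -, rfl⟩
    rw [hΦ, zero_div]
  · refine IsLUB.csSup_eq ⟨hub, fun b hb => hb ⟨J Φ, ?_, ?_⟩⟩ ⟨g, J Φ, ?_, ?_⟩
    all_goals first
      | (intro h; rw [h, map_zero, norm_zero] at h0; exact lt_irrefl _ h0)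
      | (rw [hself, eq_div_iff h0.ne']; ring)

end Spatial

/-! ### Time derivatives and continuous representatives -/

section Evolution

variable {d : ℕ} {Ω : Set (EuclideanSpace ℝ (Fin d))} {T : ℝ}

/-- The embedding `L²(Ω) → H⁻¹(Ω)` as a continuous linear map. -/
noncomputable def embHm1L (Ω : Set (EuclideanSpace ℝ (Fin d))) : L2 Ω →L[ℝ] Hm1 Ω :=
  ((ContinuousLinearMap.compL ℝ (H10 Ω) (L2 Ω) ℝ).flip (toL2 Ω)).comp (innerBilin (L2 Ω))

lemma embHm1L_apply (w : L2 Ω) : embHm1L Ω w = embHm1 Ω w := rfl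

lemma embHm1_apply (w : L2 Ω) (v : H10 Ω) : embHm1 Ω w v = inner ℝ w (toL2 Ω v) := rfl

lemma integrable_of_Lp {V : Type*} [NormedAddCommGroup V] (f : L2Time T V) :
    Integrable f (volume.restrict (Ioo 0 T)) :=
  (Lp.memLp f).integrable (by norm_num)

lemma integrable_emb (φ : X Ω T) :
    Integrable (fun t => embHm1 Ω (toL2 Ω (φ t))) (volume.restrict (Ioo 0 T)) :=
  ((embHm1L Ω).comp (toL2 Ω)).integrable_comp (integrable_of_Lp φ)

lemma IsTimeDeriv.unique {φ : X Ω T} {w w' : L2Time T (Hm1 Ω)} (h : IsTimeDeriv Ω T φ w)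
    (h' : IsTimeDeriv Ω T φ w') : w = w' :=
  Lp.ext (HasWeakTimeDeriv.ae_unique (integrable_of_Lp w) (integrable_of_Lp w') h h')

lemma IsTimeDeriv.timeDeriv_eq {φ : X Ω T} {w : L2Time T (Hm1 Ω)} (h : IsTimeDeriv Ω T φ w) :
    timeDeriv Ω T φ = w := by
  have hex : ∃ w : L2Time T (Hm1 Ω), IsTimeDeriv Ω T φ w := ⟨w, h⟩
  rw [timeDeriv, dif_pos hex]
  exact hex.choose_spec.unique h

lemma IsTimeDeriv.zero : IsTimeDeriv Ω T (0 : X Ω T) 0 := by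
  intro θ _
  rw [integral_eq_zero_of_ae, integral_eq_zero_of_ae, neg_zero]
  · filter_upwards [Lp.coeFn_zero (Hm1 Ω) 2 (volume.restrict (Ioo 0 T))] with t ht
    rw [ht]; simp
  · filter_upwards [Lp.coeFn_zero (H10 Ω) 2 (volume.restrict (Ioo 0 T))] with t ht
    rw [ht, Pi.zero_apply, map_zero, ← embHm1L_apply, map_zero]; simp

lemma IsTimeDeriv.add {φ ψ : X Ω T} {w z : L2Time T (Hm1 Ω)} (h : IsTimeDeriv Ω T φ w)
    (h' : IsTimeDeriv Ω T ψ z) : IsTimeDeriv Ω T (φ + ψ) (w + z) := by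
  intro θ hθ
  have hc : Continuous (deriv θ) := hθ.contDiff.continuous_deriv (by simp)
  have hc' := hθ.contDiff.continuous
  have e1 : ∫ t in Ioo 0 T, deriv θ t • embHm1 Ω (toL2 Ω ((φ + ψ) t))
      = ∫ t in Ioo 0 T, (deriv θ t • embHm1 Ω (toL2 Ω (φ t))
        + deriv θ t • embHm1 Ω (toL2 Ω (ψ t))) := by
    refine integral_congr_ae ?_
    filter_upwards [Lp.coeFn_add φ ψ] with t ht
    rw [ht, Pi.add_apply, map_add, ← embHm1L_apply, map_add, smul_add]
    rfl
  have e2 : ∫ t in Ioo 0 T, θ t • (w + z) t = ∫ t in Ioo 0 T, (θ t • w t + θ t • z t) := by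
    refine integral_congr_ae ?_
    filter_upwards [Lp.coeFn_add w z] with t ht
    rw [ht, Pi.add_apply, smul_add]
  rw [e1, e2, integral_add (integrable_continuous_smul hc (integrable_emb φ))
    (integrable_continuous_smul hc (integrable_emb ψ)),
    integral_add (integrable_continuous_smul hc' (integrable_of_Lp w))
    (integrable_continuous_smul hc' (integrable_of_Lp z)), h θ hθ, h' θ hθ, neg_add]

lemma IsTimeDeriv.const_smul {φ : X Ω T} {w : L2Time T (Hm1 Ω)} (c : ℝ)
    (h : IsTimeDeriv Ω T φ w) : IsTimeDeriv Ω T (c • φ) (c • w) := by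
  intro θ hθ
  have e1 : ∫ t in Ioo 0 T, deriv θ t • embHm1 Ω (toL2 Ω ((c • φ) t))
      = ∫ t in Ioo 0 T, c • (deriv θ t • embHm1 Ω (toL2 Ω (φ t))) := by
    refine integral_congr_ae ?_
    filter_upwards [Lp.coeFn_smul c φ] with t ht
    rw [ht, Pi.smul_apply, map_smul, ← embHm1L_apply, map_smul, smul_comm]
    rfl
  have e2 : ∫ t in Ioo 0 T, θ t • (c • w) t = ∫ t in Ioo 0 T, c • (θ t • w t) := by
    refine integral_congr_ae ?_
    filter_upwards [Lp.coeFn_smul c w] with t ht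
    rw [ht, Pi.smul_apply, smul_comm]
  rw [e1, e2, integral_smul, integral_smul, h θ hθ, smul_neg]

/-- This makes the choice inside `valueAt` immaterial, endpoints included. -/
lemma IsContRep.eqOn (hT : 0 < T) {φ : X Ω T} {g h : ℝ → L2 Ω} (hg : IsContRep Ω T φ g)
    (hh : IsContRep Ω T φ h) : EqOn g h (Icc 0 T) := by
  have hae : ∀ᵐ t ∂volume.restrict (Ioo 0 T), g t = h t := by
    filter_upwards [hg.2, hh.2] with t h1 h2 using h1.trans h2.symm
  have hdense : Dense {t | t ∈ Ioo 0 T → g t = h t} :=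
    Measure.dense_of_ae (μ := volume) ((ae_restrict_iff' measurableSet_Ioo).1 hae)
  have hE : EqOn g h (Ioo 0 T ∩ {t | t ∈ Ioo 0 T → g t = h t}) := fun t ht => ht.2 ht.1
  refine hE.of_subset_closure hg.1 hh.1 (fun t ht => Ioo_subset_Icc_self ht.1) ?_
  rw [← closure_Ioo hT.ne]
  exact closure_minimal (hdense.open_subset_closure_inter isOpen_Ioo) isClosed_closure

lemma IsContRep.valueAt_eq (hT : 0 < T) {φ : X Ω T} {g : ℝ → L2 Ω} (hg : IsContRep Ω T φ g)
    {s : ℝ} (hs : s ∈ Icc 0 T) : valueAt Ω T φ s = g s := by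
  have hex : ∃ g : ℝ → L2 Ω, IsContRep Ω T φ g := ⟨g, hg⟩
  rw [valueAt, dif_pos hex]
  exact hex.choose_spec.eqOn hT hg hs

lemma IsContRep.zero : IsContRep Ω T (0 : X Ω T) 0 := by
  refine ⟨continuousOn_const, ?_⟩
  filter_upwards [Lp.coeFn_zero (H10 Ω) 2 (volume.restrict (Ioo 0 T))] with t ht
  rw [ht]; simp

lemma IsContRep.add {φ ψ : X Ω T} {g h : ℝ → L2 Ω} (hg : IsContRep Ω T φ g)
    (hh : IsContRep Ω T ψ h) : IsContRep Ω T (φ + ψ) (g + h) := by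
  refine ⟨hg.1.add hh.1, ?_⟩
  filter_upwards [hg.2, hh.2, Lp.coeFn_add φ ψ] with t h1 h2 h3
  rw [h3, Pi.add_apply, Pi.add_apply, map_add, h1, h2]

lemma IsContRep.const_smul {φ : X Ω T} {g : ℝ → L2 Ω} (c : ℝ) (hg : IsContRep Ω T φ g) :
    IsContRep Ω T (c • φ) (c • g) := by
  refine ⟨hg.1.const_smul c, ?_⟩
  filter_upwards [hg.2, Lp.coeFn_smul c φ] with t h1 h3
  rw [h3, Pi.smul_apply, Pi.smul_apply, map_smul, h1]

/-- The embedding `Y ⊂ C([0, T]; L²(Ω))` and the energy identity. -/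
theorem IsTimeDeriv.exists_isContRep (hΩo : IsOpen Ω) (hΩb : Bornology.IsBounded Ω) (hT : 0 < T)
    {φ : X Ω T} {w : L2Time T (Hm1 Ω)} (h : IsTimeDeriv Ω T φ w) :
    ∃ g, IsContRep Ω T φ g ∧ ‖g T‖ ^ 2 - ‖g 0‖ ^ 2 = 2 * ∫ t in Ioo 0 T, w t (φ t) := by
  -- The Riesz map moves the weak equation from `H⁻¹(Ω)` to `H¹₀(Ω)`, where it expresses the
  -- derivative of `gramOp (toL2 Ω) φ`.
  have hweak := HasWeakTimeDeriv.clm_comp (riesz (H10 Ω)) (integrable_emb φ) (integrable_of_Lp w) h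
  simp only [riesz_embHm1] at hweak
  have hw : MemLp (fun t => riesz (H10 Ω) (w t)) 2 (volume.restrict (Ioo 0 T)) :=
    (riesz (H10 Ω)).comp_memLp' (Lp.memLp w)
  have hPi : Integrable (fun t => ContinuousLinearMap.adjoint (toL2 Ω) (toL2 Ω (φ t)))
      (volume.restrict (Ioo 0 T)) :=
    (gramOp (toL2 Ω)).integrable_comp (integrable_of_Lp φ)
  obtain ⟨c, hc⟩ := hweak.exists_eq_primitive hT hPi (hw.integrable (by norm_num))
  obtain ⟨g, g1, g2, g3, -, -⟩ := exists_continuous_representative hT (toL2_injective hΩo hΩb)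
    (Lp.memLp φ) hw hc
  refine ⟨g, ⟨g1, g2⟩, ?_⟩
  simpa only [inner_riesz] using g3

/-! ### Residuals and the isometry between `Y_T` and `X` -/

/-- The residual `φ - J ∂ₜφ`, the Riesz representative of `-∂ₜφ - Δφ`. -/
noncomputable def residual (J : Hm1 Ω →L[ℝ] H10 Ω) (φ : X Ω T) (w : L2Time T (Hm1 Ω)) : X Ω T :=
  φ - J.compLpL 2 (volume.restrict (Ioo 0 T)) w

lemma coeFn_residual (J : Hm1 Ω →L[ℝ] H10 Ω) (φ : X Ω T) (w : L2Time T (Hm1 Ω)) :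
    ∀ᵐ t ∂volume.restrict (Ioo 0 T), residual J φ w t = φ t - J (w t) := by
  filter_upwards [Lp.coeFn_sub φ (J.compLpL 2 (volume.restrict (Ioo 0 T)) w),
    J.coeFn_compLp w] with t h1 h2
  rw [residual, h1, Pi.sub_apply]
  exact congrArg _ h2

/-- The gradient on Bochner spaces. -/
noncomputable def gradX (Ω : Set (EuclideanSpace ℝ (Fin d))) (T : ℝ) :
    X Ω T →L[ℝ] L2Time T (L2Vec Ω) :=
  (grad Ω).compLpL 2 (volume.restrict (Ioo 0 T))

lemma coeFn_gradX (v : X Ω T) :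
    ∀ᵐ t ∂volume.restrict (Ioo 0 T), gradX Ω T v t = grad Ω (v t) :=
  (grad Ω).coeFn_compLp v

lemma inner_gradX (u v : X Ω T) :
    inner ℝ (gradX Ω T u) (gradX Ω T v) = ∫ t in Ioo 0 T, inner ℝ (grad Ω (u t)) (grad Ω (v t)) := by
  rw [L2.inner_def]
  refine integral_congr_ae ?_
  filter_upwards [coeFn_gradX u, coeFn_gradX v] with t h1 h2
  rw [h1, h2]

lemma norm_gradX_sq (v : X Ω T) :
    ‖gradX Ω T v‖ ^ 2 = ∫ t in Ioo 0 T, ‖grad Ω (v t)‖ ^ 2 := by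
  rw [← real_inner_self_eq_norm_sq, inner_gradX]
  simp only [real_inner_self_eq_norm_sq]

lemma normX_eq (v : X Ω T) : normX Ω T v = ‖gradX Ω T v‖ := by
  rw [normX, ← norm_gradX_sq, Real.sqrt_sq (norm_nonneg _)]

variable {J : Hm1 Ω →L[ℝ] H10 Ω}

/-- `φ ∈ Y_T` with time derivative `w`. -/
def IsAdmissible (Ω : Set (EuclideanSpace ℝ (Fin d))) (T : ℝ) (φ : X Ω T)
    (w : L2Time T (Hm1 Ω)) : Prop :=
  IsTimeDeriv Ω T φ w ∧ ∃ g, IsContRep Ω T φ g ∧ g T = 0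

lemma IsAdmissible.mem_YT (hT : 0 < T) {φ : X Ω T} {w : L2Time T (Hm1 Ω)}
    (h : IsAdmissible Ω T φ w) : φ ∈ YT Ω T := by
  obtain ⟨h1, g, hg, hgT⟩ := h
  exact ⟨⟨w, h1⟩, (hg.valueAt_eq hT ⟨hT.le, le_rfl⟩).trans hgT⟩

lemma isAdmissible_of_mem_YT (hΩo : IsOpen Ω) (hΩb : Bornology.IsBounded Ω) (hT : 0 < T)
    {φ : X Ω T} (h : φ ∈ YT Ω T) : ∃ w, IsAdmissible Ω T φ w := by
  obtain ⟨⟨w, hw⟩, hv⟩ := h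
  obtain ⟨g, hg, -⟩ := hw.exists_isContRep hΩo hΩb hT
  exact ⟨w, hw, g, hg, (hg.valueAt_eq hT ⟨hT.le, le_rfl⟩).symm.trans hv⟩

lemma IsAdmissible.BX_eq (hJ : ∀ Φ v, inner ℝ (grad Ω (J Φ)) (grad Ω v) = Φ v)
    {φ : X Ω T} {w : L2Time T (Hm1 Ω)} (h : IsAdmissible Ω T φ w) (v : X Ω T) :
    BX Ω T v φ = inner ℝ (gradX Ω T v) (gradX Ω T (residual J φ w)) := by
  rw [inner_gradX, BX, h.1.timeDeriv_eq]
  refine integral_congr_ae ?_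
  filter_upwards [coeFn_residual J φ w] with t ht
  rw [ht, map_sub, inner_sub_right, real_inner_comm (grad Ω (J (w t))), hJ]
  ring

/-- Expanding the square leaves the cross term `-2 ∫ ⟨w, φ⟩`, which equals `‖φ(0)‖²` by the energy
identity and `φ(T) = 0`. -/
lemma IsAdmissible.normYT_eq (hΩo : IsOpen Ω) (hΩb : Bornology.IsBounded Ω) (hT : 0 < T)
    (hJ : ∀ Φ v, inner ℝ (grad Ω (J Φ)) (grad Ω v) = Φ v)
    {φ : X Ω T} {w : L2Time T (Hm1 Ω)} (h : IsAdmissible Ω T φ w) :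
    normYT Ω T φ = ‖gradX Ω T (residual J φ w)‖ := by
  obtain ⟨h1, g, hg, hgT⟩ := h
  obtain ⟨g', hg', hE⟩ := h1.exists_isContRep hΩo hΩb hT
  rw [hg'.eqOn hT hg ⟨hT.le, le_rfl⟩, hgT, norm_zero] at hE
  have m1 : MemLp (fun t => grad Ω (φ t)) 2 (volume.restrict (Ioo 0 T)) :=
    (grad Ω).comp_memLp' (Lp.memLp φ)
  have m2 : MemLp (fun t => grad Ω (J (w t))) 2 (volume.restrict (Ioo 0 T)) :=
    ((grad Ω).comp J).comp_memLp' (Lp.memLp w)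
  have i1 : Integrable (fun t => w t (φ t)) (volume.restrict (Ioo 0 T)) := by
    simpa only [hJ] using integrable_inner_of_memLp m2 m1
  have i2 : Integrable (fun t => ‖grad Ω (J (w t))‖ ^ 2 + ‖grad Ω (φ t)‖ ^ 2)
      (volume.restrict (Ioo 0 T)) := m2.norm.integrable_sq.add m1.norm.integrable_sq
  have e : ‖gradX Ω T (residual J φ w)‖ ^ 2
      = ∫ t in Ioo 0 T, ((‖grad Ω (J (w t))‖ ^ 2 + ‖grad Ω (φ t)‖ ^ 2) - 2 * w t (φ t)) := by
    rw [norm_gradX_sq]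
    refine integral_congr_ae ?_
    filter_upwards [coeFn_residual J φ w] with t ht
    rw [ht, map_sub, norm_sub_sq_real, real_inner_comm, hJ]
    ring
  rw [integral_sub i2 (i1.const_mul 2), integral_const_mul] at e
  rw [normYT, h1.timeDeriv_eq, hg'.valueAt_eq hT ⟨le_rfl, hT.le⟩,
    ← Real.sqrt_sq (norm_nonneg (gradX Ω T (residual J φ w))), e]
  simp only [normHm1_eq hJ]
  congr 1
  linarith

/-- The space of residuals of elements of `Y_T`. -/
noncomputable def residualSpace (J : Hm1 Ω →L[ℝ] H10 Ω) (T : ℝ) : Submodule ℝ (X Ω T) where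
  carrier := {ρ | ∃ φ w, IsAdmissible Ω T φ w ∧ ρ = residual J φ w}
  zero_mem' := ⟨0, 0, ⟨IsTimeDeriv.zero, 0, IsContRep.zero, rfl⟩, by simp [residual]⟩
  add_mem' := by
    rintro _ _ ⟨φ, w, ⟨h1, g, hg, hgT⟩, rfl⟩ ⟨ψ, z, ⟨h2, k, hk, hkT⟩, rfl⟩
    refine ⟨φ + ψ, w + z, ⟨h1.add h2, g + k, hg.add hk, by simp [hgT, hkT]⟩, ?_⟩
    simp only [residual, map_add]
    abel
  smul_mem' := by
    rintro c _ ⟨φ, w, ⟨h1, g, hg, hgT⟩, rfl⟩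
    refine ⟨c • φ, c • w, ⟨h1.const_smul c, c • g, hg.const_smul c, by simp [hgT]⟩, ?_⟩
    simp only [residual, map_smul, smul_sub]

/-- Functions `θ(t) u(x)` with `θ(T) = 0` belong to `Y_T`. -/
lemma exists_isAdmissible_smul (hT : 0 < T) {θ : ℝ → ℝ} (hθ : ContDiff ℝ ∞ θ) (hθT : θ T = 0)
    (u : H10 Ω) : ∃ φ w, IsAdmissible Ω T φ w ∧
      (∀ᵐ t ∂volume.restrict (Ioo 0 T), φ t = θ t • u) ∧
      ∀ᵐ t ∂volume.restrict (Ioo 0 T), w t = deriv θ t • embHm1 Ω (toL2 Ω u) := by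
  have hc := hθ.continuous
  have hc' : Continuous (deriv θ) := hθ.continuous_deriv (by simp)
  have mem : ∀ {V : Type} [NormedAddCommGroup V] [NormedSpace ℝ V] {η : ℝ → ℝ} (x : V),
      Continuous η → MemLp (fun t => η t • x) 2 (volume.restrict (Ioo 0 T)) := by
    intro V _ _ η x hη
    obtain ⟨C, hC⟩ := (isCompact_Icc (a := (0 : ℝ)) (b := T)).exists_bound_of_continuousOn
      hη.continuousOn
    refine MemLp.of_bound (hη.aestronglyMeasurable.smul_const x) (C * ‖x‖) ?_
    filter_upwards [ae_restrict_mem measurableSet_Ioo] with t ht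
    rw [norm_smul]
    gcongr
    exact hC t (Ioo_subset_Icc_self ht)
  have h1 := mem u hc
  have h2 := mem (embHm1 Ω (toL2 Ω u)) hc'
  refine ⟨h1.toLp _, h2.toLp _, ⟨?_, fun t => θ t • toL2 Ω u, ⟨?_, ?_⟩, ?_⟩, h1.coeFn_toLp,
    h2.coeFn_toLp⟩
  · intro ψ hψ
    have e1 : ∫ t in Ioo 0 T, deriv ψ t • embHm1 Ω (toL2 Ω (h1.toLp _ t))
        = ∫ t in Ioo 0 T, (deriv ψ t • θ t) • embHm1 Ω (toL2 Ω u) := by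
      refine integral_congr_ae ?_
      filter_upwards [h1.coeFn_toLp] with t ht
      rw [ht, map_smul, ← embHm1L_apply, map_smul, smul_assoc]
      rfl
    have e2 : ∫ t in Ioo 0 T, ψ t • h2.toLp _ t
        = ∫ t in Ioo 0 T, (ψ t • deriv θ t) • embHm1 Ω (toL2 Ω u) := by
      refine integral_congr_ae ?_
      filter_upwards [h2.coeFn_toLp] with t ht
      rw [ht, smul_assoc]
    have hp : ∀ t ∈ uIcc 0 T, θ t = θ 0 + ∫ r in (0 : ℝ)..t, deriv θ r := fun t _ => by
      rw [intervalIntegral.integral_deriv_eq_sub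
        (fun x _ => (hθ.differentiable (by simp)).differentiableAt) (hc'.intervalIntegrable _ _)]
      ring
    have e3 := integral_deriv_smul_primitive (hc'.intervalIntegrable 0 T) hp
      (hψ.contDiff.of_le (by simp) : ContDiff ℝ 1 ψ)
    rw [e1, e2, integral_smul_const, integral_smul_const, setIntegral_Ioo_eq_intervalIntegral hT.le,
      setIntegral_Ioo_eq_intervalIntegral hT.le, e3, hψ.eq_zero (t := T) (by simp),
      hψ.eq_zero (t := 0) (by simp)]
    simp
  · exact (hc.smul continuous_const).continuousOn
  · filter_upwards [h1.coeFn_toLp] with t ht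
    rw [ht, map_smul]
  · simp [hθT]

end Evolution

/-! ### Density of the residuals -/

section Duality

variable {d : ℕ} {Ω : Set (EuclideanSpace ℝ (Fin d))} {T : ℝ} {J : Hm1 Ω →L[ℝ] H10 Ω}

/-- An element of `X` orthogonal to all residuals solves, after applying the inverse Dirichlet
Laplacian, the heat equation in the very weak sense. -/
lemma integral_deriv_smul_eq_of_orthogonal (hT : 0 < T)
    (hJ : ∀ Φ v, inner ℝ (grad Ω (J Φ)) (grad Ω v) = Φ v) {z : X Ω T}
    (hz : z ∈ (residualSpace J T)ᗮ) {θ : ℝ → ℝ} (hθ : ContDiff ℝ ∞ θ) (hθT : θ T = 0) :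
    ∫ t in Ioo 0 T, deriv θ t • gramOp (toL2 Ω) (J (innerBilin _ (z t)))
      = ∫ t in Ioo 0 T, θ t • z t := by
  have hc := hθ.continuous
  have hc' : Continuous (deriv θ) := hθ.continuous_deriv (by simp)
  -- Orthogonality in `X` refers to the full `H¹` inner product; `K` represents that product through
  -- the Dirichlet form.
  set K : H10 Ω →L[ℝ] H10 Ω := J.comp (innerBilin (H10 Ω)) with hK
  have iz := integrable_of_Lp z
  have iK : Integrable (fun t => gramOp (toL2 Ω) (K (z t))) (volume.restrict (Ioo 0 T)) :=
    ((gramOp (toL2 Ω)).comp K).integrable_comp iz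
  have i1 := integrable_continuous_smul hc iz
  have i2 := integrable_continuous_smul hc' iK
  refine ext_inner_left ℝ fun u => ?_
  obtain ⟨φ, w, hφ, hφt, hwt⟩ := exists_isAdmissible_smul (Ω := Ω) hT hθ hθT u
  have h0 : inner ℝ (residual J φ w) z = 0 := hz _ ⟨φ, w, hφ, rfl⟩
  change inner ℝ u (∫ t in Ioo 0 T, deriv θ t • gramOp (toL2 Ω) (K (z t))) = _
  have e1 : inner ℝ u (∫ t in Ioo 0 T, deriv θ t • gramOp (toL2 Ω) (K (z t)))
      = ∫ t in Ioo 0 T, inner ℝ u (deriv θ t • gramOp (toL2 Ω) (K (z t))) :=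
    ((innerBilin (H10 Ω) u).integral_comp_comm i2).symm
  have e2 : inner ℝ u (∫ t in Ioo 0 T, θ t • z t) = ∫ t in Ioo 0 T, inner ℝ u (θ t • z t) :=
    ((innerBilin (H10 Ω) u).integral_comp_comm i1).symm
  have i1' : Integrable (fun t => inner ℝ u (θ t • z t)) (volume.restrict (Ioo 0 T)) :=
    (innerBilin (H10 Ω) u).integrable_comp i1
  have i2' : Integrable (fun t => inner ℝ u (deriv θ t • gramOp (toL2 Ω) (K (z t))))
      (volume.restrict (Ioo 0 T)) := (innerBilin (H10 Ω) u).integrable_comp i2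
  rw [e1, e2, eq_comm, ← sub_eq_zero, ← integral_sub i1' i2']
  rw [L2.inner_def] at h0
  refine (integral_congr_ae ?_).trans h0
  filter_upwards [coeFn_residual J φ w, hφt, hwt] with t h1 h2 h3
  -- Symmetry of the Dirichlet form: both sides equal `(∇J w, ∇K z)`.
  have e3 : inner ℝ (J (w t)) (z t) = w t (K (z t)) := by
    rw [← hJ, real_inner_comm, real_inner_comm (grad Ω (K (z t))), hK,
      ContinuousLinearMap.comp_apply, hJ, innerBilin_apply]
  rw [h1, inner_sub_left, e3, h2, h3, real_inner_smul_left, real_inner_smul_right,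
    real_inner_smul_right, smul_apply, smul_eq_mul, embHm1_apply,
    ← inner_gramOp, gramOp_symm]

/-- Uniqueness for the heat equation: the residuals are dense in `X`. -/
theorem residualSpace_orthogonal (hΩo : IsOpen Ω) (hΩb : Bornology.IsBounded Ω) (hT : 0 < T)
    (hJ : ∀ Φ v, inner ℝ (grad Ω (J Φ)) (grad Ω v) = Φ v) : (residualSpace J T)ᗮ = ⊥ := by
  rw [Submodule.eq_bot_iff]
  intro z hz
  set K : H10 Ω →L[ℝ] H10 Ω := J.comp (innerBilin (H10 Ω)) with hK
  have hKz : ∀ x y, inner ℝ (grad Ω (K x)) (grad Ω y) = inner ℝ x y := fun x y => hJ _ y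
  have hzm := Lp.memLp z
  have iz := integrable_of_Lp z
  have hf : MemLp (fun t => K (z t)) 2 (volume.restrict (Ioo 0 T)) := K.comp_memLp' hzm
  have key := fun {θ : ℝ → ℝ} (h1 : ContDiff ℝ ∞ θ) (h2 : θ T = 0) =>
    integral_deriv_smul_eq_of_orthogonal hT hJ hz h1 h2
  change ∀ {θ : ℝ → ℝ}, ContDiff ℝ ∞ θ → θ T = 0 →
    ∫ t in Ioo 0 T, deriv θ t • gramOp (toL2 Ω) (K (z t)) = ∫ t in Ioo 0 T, θ t • z t at key
  have iP : Integrable (fun t => gramOp (toL2 Ω) (K (z t))) (volume.restrict (Ioo 0 T)) :=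
    ((gramOp (toL2 Ω)).comp K).integrable_comp iz
  have hweak : HasWeakTimeDeriv T (fun t => gramOp (toL2 Ω) (K (z t))) fun t => -z t := by
    intro θ hθ
    rw [key hθ.contDiff (hθ.eq_zero (by simp))]
    simp [integral_neg]
  obtain ⟨c, hc⟩ := hweak.exists_eq_primitive hT iP iz.neg
  obtain ⟨g, -, -, hE, hcl, hadj⟩ :=
    exists_continuous_representative hT (toL2_injective hΩo hΩb) hf hzm.neg hc
  -- The function `θ(t) = T - t` vanishes at `T` but not at `0`. Integration by parts leaves the
  -- boundary term `-T c`, which must therefore be zero.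
  have hc0 : c = 0 := by
    have hθ : ContDiff ℝ ∞ fun t : ℝ => T - t := contDiff_const.sub contDiff_id
    have hder : deriv (fun t : ℝ => T - t) = fun _ => -1 := by
      ext t; simp
    have h1 := key hθ (sub_self T)
    have h2 := integral_deriv_smul_primitive (a := 0) (b := T)
      (k := fun t => c + ∫ r in (0 : ℝ)..t, -z r) (intervalIntegrable_of_integrable_Ioo hT.le iz.neg)
      (fun t _ => by simp) (hθ.of_le (by simp) : ContDiff ℝ 1 fun t : ℝ => T - t)
    have h3 : ∫ t in Ioo 0 T, deriv (fun t : ℝ => T - t) t • gramOp (toL2 Ω) (K (z t))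
        = ∫ t in Ioo 0 T, deriv (fun t : ℝ => T - t) t • (c + ∫ r in (0 : ℝ)..t, -z r) := by
      refine integral_congr_ae ?_
      filter_upwards [hc] with t ht
      exact congrArg _ ht
    rw [h3, setIntegral_Ioo_eq_intervalIntegral hT.le, h2,
      setIntegral_Ioo_eq_intervalIntegral hT.le] at h1
    have h4 : T • c = 0 := by simpa using h1
    exact (smul_eq_zero.1 h4).resolve_left hT.ne'
  -- As `i† g(0) = c = 0`, the vector `g(0)` is orthogonal to the range of `i`, yet it lies in the
  -- closure of that range.
  have hg0 : g 0 = 0 := by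
    have h1 : ContinuousLinearMap.adjoint (toL2 Ω) (g 0) = 0 := by
      rw [hadj 0 ⟨le_rfl, hT.le⟩, hc0]; simp
    have hsub : range (toL2 Ω) ⊆ {y | inner ℝ (g 0) y = 0} := by
      rintro _ ⟨x, rfl⟩
      rw [mem_ofPred_eq, ← ContinuousLinearMap.adjoint_inner_left, h1, inner_zero_left]
    have h2 := closure_minimal hsub (isClosed_eq (continuous_const.inner continuous_id)
      continuous_const) (hcl 0 ⟨le_rfl, hT.le⟩)
    exact inner_self_eq_zero.1 h2
  -- With `g(0) = 0` the energy identity reads `‖g(T)‖² = -2 ∫ ‖∇Kz‖²`, so both sides vanish.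
  have hint : ∫ t in Ioo 0 T, ‖grad Ω (K (z t))‖ ^ 2 = 0 := by
    have e : ∫ t in Ioo 0 T, inner ℝ (-z t) (K (z t))
        = - ∫ t in Ioo 0 T, ‖grad Ω (K (z t))‖ ^ 2 := by
      rw [← integral_neg]
      congr 1 with t
      rw [inner_neg_left, ← hKz, real_inner_self_eq_norm_sq]
    rw [hg0, norm_zero] at hE
    have e' : ‖g T‖ ^ 2 - 0 ^ 2 = 2 * ∫ t in Ioo 0 T, inner ℝ (-z t) (K (z t)) := hE
    rw [e] at e'
    have : 0 ≤ ∫ t in Ioo 0 T, ‖grad Ω (K (z t))‖ ^ 2 := integral_nonneg fun _ => sq_nonneg _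
    nlinarith [sq_nonneg ‖g T‖]
  have hi : Integrable (fun t => ‖grad Ω (K (z t))‖ ^ 2) (volume.restrict (Ioo 0 T)) :=
    ((grad Ω).comp_memLp' hf).norm.integrable_sq
  rw [integral_eq_zero_iff_of_nonneg (fun _ => sq_nonneg _) hi] at hint
  rw [Lp.eq_zero_iff_ae_eq_zero]
  filter_upwards [hint] with t ht
  have h1 : grad Ω (K (z t)) = 0 := by simpa using ht
  have h2 := hKz (z t) (z t)
  rw [h1, inner_zero_left] at h2
  exact inner_self_eq_zero.1 h2.symm

/-- The witness is `(T - t) u(x)`. It keeps the set of quotients nonempty, which matters for the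
least upper bound when `‖v‖_X = 0`. -/
lemma exists_mem_YT_ne_zero (hΩo : IsOpen Ω) (hΩn : Ω.Nonempty) (hT : 0 < T) :
    ∃ φ ∈ YT Ω T, φ ≠ 0 := by
  obtain ⟨u, hu⟩ := exists_H10_ne_zero hΩo hΩn
  obtain ⟨φ, w, h, hφ, -⟩ := exists_isAdmissible_smul (Ω := Ω) hT (θ := fun t => T - t)
    (contDiff_const.sub contDiff_id) (sub_self T) u
  refine ⟨φ, h.mem_YT hT, fun h0 => ?_⟩
  rw [Lp.eq_zero_iff_ae_eq_zero] at h0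
  have hbad : ∀ᵐ t ∂volume.restrict (Ioo 0 T), False := by
    filter_upwards [h0, hφ, ae_restrict_mem measurableSet_Ioo] with t h1 h2 h3
    rw [h1, Pi.zero_apply, eq_comm, smul_eq_zero] at h2
    exact h2.elim (fun h => by linarith [h3.2]) hu
  rw [Filter.eventually_false_iff_eq_bot, ae_eq_bot, Measure.restrict_eq_zero, Real.volume_Ioo,
    ENNReal.ofReal_eq_zero] at hbad
  linarith

lemma normYT_nonneg (φ : X Ω T) : 0 ≤ normYT Ω T φ := Real.sqrt_nonneg _

end Duality

end HeatSpaces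

/-! ### The inf–sup identity -/

theorem mainTheorem6 (d : ℕ) (hd : 1 ≤ d) (Ω : Set (EuclideanSpace ℝ (Fin d)))
    (hΩo : IsOpen Ω) (hΩb : Bornology.IsBounded Ω) (hΩn : Ω.Nonempty)
    (T : ℝ) (hT : 0 < T) (v : HeatSpaces.X Ω T) :
    IsLUB {r : ℝ | ∃ φ ∈ HeatSpaces.YT Ω T, φ ≠ 0 ∧
        r = HeatSpaces.BX Ω T v φ / HeatSpaces.normYT Ω T φ}
      (HeatSpaces.normX Ω T v) := by
  obtain ⟨J, hJ⟩ := HeatSpaces.exists_dirichlet_inverse hd hΩo hΩb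
  rw [HeatSpaces.normX_eq]
  constructor
  · rintro r ⟨φ, hφ, -, rfl⟩
    obtain ⟨w, hw⟩ := HeatSpaces.isAdmissible_of_mem_YT hΩo hΩb hT hφ
    refine div_le_of_le_mul₀ (HeatSpaces.normYT_nonneg _) (norm_nonneg _) ?_
    rw [hw.BX_eq hJ, hw.normYT_eq hΩo hΩb hT hJ]
    exact real_inner_le_norm _ _
  · intro b hb
    set G := HeatSpaces.gradX Ω T
    -- Multiplied out, the bound is a closed condition on `ρ`, valid also where `∇ρ = 0`; density
    -- extends it to all of `X`, in particular to `ρ = v`.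
    have hres : ∀ ρ ∈ HeatSpaces.residualSpace J T, inner ℝ (G v) (G ρ) ≤ b * ‖G ρ‖ := by
      rintro ρ ⟨φ, w, hw, rfl⟩
      rcases (norm_nonneg (G (HeatSpaces.residual J φ w))).eq_or_lt with h0 | h0
      · rw [← h0, norm_eq_zero.1 h0.symm, inner_zero_right, mul_zero]
      -- By uniqueness of the time derivative, `φ = 0` would give a zero residual.
      · have hφ0 : φ ≠ 0 := by
          rintro rfl
          rw [hw.1.unique HeatSpaces.IsTimeDeriv.zero, HeatSpaces.residual, map_zero, sub_zero,
            map_zero, norm_zero] at h0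
          exact lt_irrefl _ h0
        have := hb ⟨φ, hw.mem_YT hT, hφ0, rfl⟩
        rwa [hw.BX_eq hJ, hw.normYT_eq hΩo hΩb hT hJ, div_le_iff₀ h0] at this
    have hcl : IsClosed {ρ | inner ℝ (G v) (G ρ) ≤ b * ‖G ρ‖} :=
      isClosed_le (continuous_const.inner G.continuous) (G.continuous.norm.const_mul b)
    have htop : (HeatSpaces.residualSpace J T).topologicalClosure = ⊤ :=
      Submodule.topologicalClosure_eq_top_iff.2
        (HeatSpaces.residualSpace_orthogonal hΩo hΩb hT hJ)
    have hmem : v ∈ (HeatSpaces.residualSpace J T).topologicalClosure := htop ▸ Submodule.mem_top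
    have hv : inner ℝ (G v) (G v) ≤ b * ‖G v‖ := closure_minimal hres hcl hmem
    rcases (norm_nonneg (G v)).eq_or_lt with h0 | h0
    -- When `∇v = 0` the inequality `hv` is empty; `0 ≤ b` holds because every quotient is zero and
    -- at least one exists.
    · rw [← h0]
      obtain ⟨φ, hφ, hne⟩ := HeatSpaces.exists_mem_YT_ne_zero hΩo hΩn hT
      obtain ⟨w, hw⟩ := HeatSpaces.isAdmissible_of_mem_YT hΩo hΩb hT hφ
      refine hb ⟨φ, hφ, hne, ?_⟩
      rw [hw.BX_eq hJ, norm_eq_zero.1 h0.symm, inner_zero_left, zero_div]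
    · rw [real_inner_self_eq_norm_mul_norm] at hv
      exact le_of_mul_le_mul_right hv h0
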